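/- Let $p_1\le p_2\le p_3$ be real numbers with $\sum_j p_j=\sum_j p_j^2=1$ and $(p_1,p_2,p_3)\neq(0,0,1)$, and let $L>0$. *Kasner spacetime* is $\{(t,x^1,x^2,x^3)\in\mathbb R^4 : t>0\}$ with the metric $ds^2=-dt^2+\sum_{j=1}^3 t^{2p_j}(dx^j)^2$, time oriented by $\partial_t$; *c-Kasner spacetime* is its quotient by $x^1\sim x^1+L$. Definitions. For a spacelike embedded submanifold $S$ with coordinate frame $e_\alpha$ and induced metric $h_{\alpha\beta}$, the mean curvature vector is $H=-h^{\alpha\beta}(\nabla_{e_\alpha}e_\beta)^{\perp}$. A *$k$-dimensional closed trapped submanifold* is a nonempty compact boundaryless embedded spacelike $k$-dimensional submanifold whose mean curvature vector is future timelike at every point (a closed trapped surface if $k=2$, a trapped loop if $k=1$). A spacelike/null hypersurface $\Sigma$ (every tangent space is spacelike or null) with future pointing normal field $N$ is *$k$-future convex* if for every $p\in\Sigma$ and every spacelike $k$-dimensional subspace $W\subset T_p\Sigma$ the trace of $(\nabla_aN_b)|_{W\otimes W}$ with respect to the induced metric on $W$ is $\ge 0$; it is *future convex* if $X^aX^b\nabla_aN_b\ge0$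 for every spacelike vector $X$ tangent to $\Sigma$. Then: 1. $-\tfrac13\le p_1<0<p_2\le p_3<1$, and Kasner spacetime is Ricci flat. 2. The smooth function $g=x^1-\dfrac{t^{1-p_1}}{1-p_1}$ on Kasner spacetime has everywhere future null gradient (in particular $g^{ab}\nabla_ag\nabla_bg=0$), and all its level sets are future convex (null) hypersurfaces. 3. Kasner spacetime contains no closed trapped submanifold of any dimension. 4. In Kasner and in c-Kasner spacetime, every hypersurface $t=t_0$ $(t_0>0)$ is $3$-future convex and $2$-future convex but not $1$-future convex. 5. c-Kasner spacetime contains no closed trapped surface. 6. In c-Kasner spacetime, for all $t_0>0$ and $a,b\in\mathbb R$, the $x^1$-loop $\{t=t_0,\ x^2=a,\ x^3=b\}$ is a trapped loop. -/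

import Mathlib

open scoped Manifold ContDiff

noncomputable section

/-! ### Lorentzian geometry in charts -/

namespace Lorentz

/-- The model space `ℝᵐ`. -/
abbrev Model (m : ℕ) : Type := EuclideanSpace ℝ (Fin m)

/-- The `i`-th vector of the standard basis of `ℝᵐ`. -/
def stdVec {m : ℕ} (i : Fin m) : Model m := EuclideanSpace.single i (1 : ℝ)

/-- The partial derivative `∂ᵢ f` at `y`. -/
def pderiv {m : ℕ} {F : Type*} [NormedAddCommGroup F] [NormedSpace ℝ F]
    (i : Fin m) (f : Model m → F) (y : Model m) : F :=
  fderiv ℝ f y (stdVec i)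

/-- The Christoffel symbols `Γᶜₐᵦ = ½ gᶜᵈ (∂ₐ g_dᵦ + ∂ᵦ g_da - ∂_d gₐᵦ)` of a metric on (an open
subset of) `ℝᵐ` with component matrix `G`. -/
def christoffel {m : ℕ} (G : Model m → Matrix (Fin m) (Fin m) ℝ) (c a b : Fin m)
    (y : Model m) : ℝ :=
  (1 / 2) * ∑ d, (G y)⁻¹ c d *
    (pderiv a (fun z => G z d b) y + pderiv b (fun z => G z d a) y
      - pderiv d (fun z => G z a b) y)

/-- The vector `Γ(v, w)` with components `Γᶜₐᵦ vᵃ wᵇ`. -/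
def christoffelVec {m : ℕ} (G : Model m → Matrix (Fin m) (Fin m) ℝ) (y v w : Model m) : Model m :=
  ∑ c, (∑ a, ∑ b, christoffel G c a b y * v a * w b) • stdVec c

/-- The components `R_bd = ∂ₐ Γᵃ_bd - ∂_d Γᵃ_ab + Γᵃ_ae Γᵉ_bd - Γᵃ_de Γᵉ_ab` of the Ricci tensor. -/
def ricci {m : ℕ} (G : Model m → Matrix (Fin m) (Fin m) ℝ) (b d : Fin m) (y : Model m) : ℝ :=
  ∑ a, (pderiv a (christoffel G a b d) y - pderiv d (christoffel G a a b) y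
    + ∑ e, (christoffel G a a e y * christoffel G e b d y
      - christoffel G a d e y * christoffel G e a b y))

/-- The component matrix, in the chart around `p`, of a field `g` of bilinear forms on the
tangent spaces of `M`. -/
def chartComponents {m : ℕ} {M : Type*} [TopologicalSpace M] [ChartedSpace (Model m) M]
    (g : ∀ q : M, LinearMap.BilinForm ℝ (TangentSpace (𝓡 m) q)) (p : M) (y : Model m) :
    Matrix (Fin m) (Fin m) ℝ :=
  Matrix.of fun i j =>
    g ((extChartAt (𝓡 m) p).symm y)
      (mfderiv (𝓡 m) (𝓡 m) (extChartAt (𝓡 m) p).symm y (stdVec i))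
      (mfderiv (𝓡 m) (𝓡 m) (extChartAt (𝓡 m) p).symm y (stdVec j))

/-- The component vector, in the chart around `p`, of a vector field `X` on `M`. -/
def chartVector {m : ℕ} {M : Type*} [TopologicalSpace M] [ChartedSpace (Model m) M]
    (X : ∀ q : M, TangentSpace (𝓡 m) q) (p : M) (y : Model m) : Model m :=
  mfderiv (𝓡 m) (𝓡 m) (extChartAt (𝓡 m) p) ((extChartAt (𝓡 m) p).symm y)
    (X ((extChartAt (𝓡 m) p).symm y))

/-- The vector field `X` is smooth on the subset `U` of `M`. -/
def IsSmoothVectorFieldOn {m : ℕ} {M : Type*} [TopologicalSpace M] [ChartedSpace (Model m) M]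
    (X : ∀ q : M, TangentSpace (𝓡 m) q) (U : Set M) : Prop :=
  ∀ p : M, ContDiffOn ℝ ∞ (chartVector X p)
    ((extChartAt (𝓡 m) p).target ∩ (extChartAt (𝓡 m) p).symm ⁻¹' U)

/-- A time-oriented Lorentzian manifold (signature `(-,+,…,+)`) of dimension `m`.  The time
orientation is given by a smooth timelike vector field `time`, declared to be future pointing;
the signature condition says that the metric is negative on `time` and positive definite on its
orthogonal complement. -/
structure Spacetime (m : ℕ) (M : Type*) [TopologicalSpace M] [ChartedSpace (Model m) M] where
  isManifold : IsManifold (𝓡 m) ∞ M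
  t2Space : T2Space M
  secondCountable : SecondCountableTopology M
  metric : ∀ q : M, LinearMap.BilinForm ℝ (TangentSpace (𝓡 m) q)
  time : ∀ q : M, TangentSpace (𝓡 m) q
  metric_symm : ∀ (q : M) (v w : TangentSpace (𝓡 m) q), metric q v w = metric q w v
  metric_smooth : ∀ (p : M) (i j : Fin m),
    ContDiffOn ℝ ∞ (fun y => chartComponents metric p y i j) (extChartAt (𝓡 m) p).target
  time_smooth : IsSmoothVectorFieldOn time Set.univ
  time_timelike : ∀ q : M, metric q (time q) (time q) < 0
  orthogonal_pos : ∀ (q : M) (v : TangentSpace (𝓡 m) q),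
    metric q (time q) v = 0 → v ≠ 0 → 0 < metric q v v

namespace Spacetime

variable {m : ℕ} {M : Type*} [TopologicalSpace M] [ChartedSpace (Model m) M] (S : Spacetime m M)

/-- The metric component matrix in the chart around `p`. -/
def components (p : M) : Model m → Matrix (Fin m) (Fin m) ℝ :=
  chartComponents S.metric p

/-- The vacuum Einstein equations: the Ricci tensor vanishes. -/
def IsVacuum : Prop :=
  ∀ (p : M) (b d : Fin m), ricci (S.components p) b d (extChartAt (𝓡 m) p p) = 0

/-- `v` is future causal: `v ≠ 0`, `⟨v, v⟩ ≤ 0`, and `v` lies in the same half cone as `time`. -/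
def IsFutureCausal (q : M) (v : TangentSpace (𝓡 m) q) : Prop :=
  v ≠ 0 ∧ S.metric q v v ≤ 0 ∧ S.metric q v (S.time q) < 0

/-- `v` is future timelike. -/
def IsFutureTimelike (q : M) (v : TangentSpace (𝓡 m) q) : Prop :=
  S.metric q v v < 0 ∧ S.metric q v (S.time q) < 0

/-- `v` is future null. -/
def IsFutureNull (q : M) (v : TangentSpace (𝓡 m) q) : Prop :=
  v ≠ 0 ∧ S.metric q v v = 0 ∧ S.metric q v (S.time q) < 0

/-- `v` is the gradient of `f` at `q`: `⟨v, w⟩ = df(w)` for all `w`. -/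
def IsGradient (f : M → ℝ) (q : M) (v : TangentSpace (𝓡 m) q) : Prop :=
  ∀ w : TangentSpace (𝓡 m) q, S.metric q v w = mfderiv (𝓡 m) 𝓘(ℝ, ℝ) f q w

/-- The covariant derivative `∇_v X` at `q` for the Levi-Civita connection, computed in the chart
around `q` (which is the chart that Mathlib uses to identify `TangentSpace (𝓡 m) q`
with `ℝᵐ`). -/
def covDeriv (X : ∀ q : M, TangentSpace (𝓡 m) q) (q : M) (v : TangentSpace (𝓡 m) q) :
    TangentSpace (𝓡 m) q :=
  let y : Model m := extChartAt (𝓡 m) q q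
  (fderiv ℝ (chartVector X q) y v + christoffelVec (S.components q) y v (chartVector X q y) :
    Model m)

/-- The Gram matrix of a family of tangent vectors at `q`. -/
def gram {k : ℕ} (q : M) (w : Fin k → TangentSpace (𝓡 m) q) : Matrix (Fin k) (Fin k) ℝ :=
  Matrix.of fun α β => S.metric q (w α) (w β)

/-! #### Mean curvature and closed trapped submanifolds -/

section Submanifold

variable {k : ℕ} {P : Type*} [TopologicalSpace P] [ChartedSpace (Model k) P]

/-- The coordinate frame `e_α = ∂x/∂u^α` at `Φ x` of a parametrized submanifold `Φ : P → M`. -/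
def frame (Φ : P → M) (x : P) (α : Fin k) : TangentSpace (𝓡 m) (Φ x) :=
  mfderiv (𝓡 k) (𝓡 m) Φ x (stdVec α : Model k)

/-- `∇_{e_α} e_β = ∂_α ∂_β x + Γ(e_α, e_β)` at `Φ x`. -/
def frameAccel (Φ : P → M) (x : P) (α β : Fin k) : TangentSpace (𝓡 m) (Φ x) :=
  (pderiv α (pderiv β (writtenInExtChartAt (𝓡 k) (𝓡 m) x Φ)) (extChartAt (𝓡 k) x x)
    + christoffelVec (S.components (Φ x)) (extChartAt (𝓡 m) (Φ x) (Φ x))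
        (frame Φ x α) (frame Φ x β) : Model m)

/-- The component of `v` normal to the submanifold, `v - h^{γδ} ⟨v, e_γ⟩ e_δ`. -/
def normalPart (Φ : P → M) (x : P) (v : TangentSpace (𝓡 m) (Φ x)) : TangentSpace (𝓡 m) (Φ x) :=
  v - ∑ γ : Fin k, ∑ δ : Fin k,
    ((S.gram (Φ x) (frame Φ x))⁻¹ γ δ * S.metric (Φ x) v (frame Φ x γ)) • frame Φ x δ

/-- The mean curvature vector `H = - h^{αβ} (∇_{e_α} e_β)^⊥`. -/
def meanCurvature (Φ : P → M) (x : P) : TangentSpace (𝓡 m) (Φ x) :=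
  -∑ α : Fin k, ∑ β : Fin k,
    (S.gram (Φ x) (frame Φ x))⁻¹ α β • S.normalPart (k := k) Φ x (S.frameAccel Φ x α β)

end Submanifold

/-- `C` is a `k`-dimensional closed trapped submanifold: the image of a nonempty compact
`k`-manifold without boundary under a smooth embedding whose induced metric is positive definite
and whose mean curvature vector is everywhere future timelike. -/
def IsClosedTrapped {m : ℕ} {M : Type} [TopologicalSpace M] [ChartedSpace (Model m) M]
    (S : Spacetime m M) (k : ℕ) (C : Set M) : Prop :=
  ∃ (P : Type) (_ : TopologicalSpace P) (_ : ChartedSpace (Model k) P) (Φ : P → M),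
    IsManifold (𝓡 k) ∞ P ∧ CompactSpace P ∧ Nonempty P ∧
    Manifold.IsSmoothEmbedding (𝓡 k) (𝓡 m) ∞ Φ ∧ Set.range Φ = C ∧
    (∀ x : P, (S.gram (Φ x) (frame Φ x : Fin k → TangentSpace (𝓡 m) (Φ x))).PosDef) ∧
    ∀ x : P, S.IsFutureTimelike (Φ x) (S.meanCurvature (k := k) Φ x)

/-! #### Future convex hypersurfaces -/

/-- On the open set `U`, the set `H` is the hypersurface `f = 0` (`f` smooth, `df ≠ 0` on `H`, so
that `T_q H = ker df_q`), and `N` is a smooth vector field that along `H` is normal to `H` and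
future causal; in particular, `H` is spacelike or null at each of its points in `U`. -/
def IsHypersurfaceWithNormal (H U : Set M) (f : M → ℝ) (N : ∀ q : M, TangentSpace (𝓡 m) q) :
    Prop :=
  IsOpen U ∧ ContMDiffOn (𝓡 m) 𝓘(ℝ, ℝ) ∞ f U ∧ IsSmoothVectorFieldOn N U ∧
  (∀ q ∈ U, q ∈ H ↔ f q = 0) ∧
  ∀ q ∈ H ∩ U, mfderiv (𝓡 m) 𝓘(ℝ, ℝ) f q ≠ 0 ∧ S.IsFutureCausal q (N q) ∧
    ∀ v : TangentSpace (𝓡 m) q, mfderiv (𝓡 m) 𝓘(ℝ, ℝ) f q v = 0 → S.metric q (N q) v = 0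

/-- `H` is a `k`-future convex spacelike/null hypersurface: for every spacelike `k`-dimensional
subspace `W` of a tangent space of `H`, with basis `w` and metric matrix `h` in this basis,
`h^{αβ} ⟨∇_{w_α} N, w_β⟩ ≥ 0`, where `N` is a future pointing normal field (whose choice does
not matter). -/
def IsKFutureConvex (k : ℕ) (H : Set M) : Prop :=
  ∀ p ∈ H, ∃ (U : Set M) (f : M → ℝ) (N : ∀ q : M, TangentSpace (𝓡 m) q),
    p ∈ U ∧ S.IsHypersurfaceWithNormal H U f N ∧
    ∀ q ∈ H ∩ U, ∀ w : Fin k → TangentSpace (𝓡 m) q,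
      (∀ α, mfderiv (𝓡 m) 𝓘(ℝ, ℝ) f q (w α) = 0) → (S.gram q w).PosDef →
      0 ≤ ∑ α, ∑ β, (S.gram q w)⁻¹ α β * S.metric q (S.covDeriv N q (w α)) (w β)

/-- `H` is a future convex spacelike/null hypersurface: `⟨∇_X N, X⟩ ≥ 0` for every spacelike
vector `X` tangent to `H`, where `N` is a future pointing normal field (whose choice does
not matter). -/
def IsFutureConvex (H : Set M) : Prop :=
  ∀ p ∈ H, ∃ (U : Set M) (f : M → ℝ) (N : ∀ q : M, TangentSpace (𝓡 m) q),
    p ∈ U ∧ S.IsHypersurfaceWithNormal H U f N ∧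
    ∀ q ∈ H ∩ U, ∀ X : TangentSpace (𝓡 m) q,
      mfderiv (𝓡 m) 𝓘(ℝ, ℝ) f q X = 0 → 0 < S.metric q X X →
      0 ≤ S.metric q (S.covDeriv N q X) X

end Spacetime

end Lorentz

/-! ### Kasner spacetime and its compactification in the first spatial direction -/

namespace Kasner

open Lorentz TopologicalSpace

/-- The open half space `{(t, x¹, x², x³) | t > 0}` of `ℝ⁴`, with `t` the coordinate `0`. -/
def halfSpace : Opens (Model 4) :=
  ⟨{x | 0 < x 0}, isOpen_lt continuous_const (by fun_prop)⟩

/-- The underlying manifold of Kasner spacetime. -/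
abbrev Kas : Type := halfSpace

/-- The underlying space `(0, ∞) × (ℝ / Lℤ) × ℝ × ℝ` of Kasner spacetime compactified by
`x¹ ∼ x¹ + L`. -/
abbrev CKas (L : ℝ) : Type := Set.Ioi (0 : ℝ) × AddCircle L × ℝ × ℝ

/-- The quotient map from Kasner spacetime to its compactification. -/
def quot (L : ℝ) (x : Kas) : CKas L :=
  (⟨x.1 0, x.2⟩, (x.1 1 : AddCircle L), x.1 2, x.1 3)

theorem quot_surjective (L : ℝ) : Function.Surjective (quot L) := by
  rintro ⟨⟨t, ht⟩, θ, a, b⟩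
  obtain ⟨s, rfl⟩ := QuotientAddGroup.mk_surjective θ
  exact ⟨⟨!₂[t, s, a, b], by simpa [halfSpace] using ht⟩, by simp [quot]⟩

/-- Kasner spacetime as a product of its coordinate ranges. -/
def coordHomeo : Kas ≃ₜ (Set.Ioi (0 : ℝ) × ℝ × ℝ × ℝ) where
  toFun x := (⟨x.1 0, x.2⟩, x.1 1, x.1 2, x.1 3)
  invFun z := ⟨!₂[z.1.1, z.2.1, z.2.2.1, z.2.2.2], z.1.2⟩
  left_inv x := by
    ext i
    fin_cases i <;> rfl
  right_inv z := rfl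
  continuous_toFun := by fun_prop
  continuous_invFun := by
    refine Continuous.subtype_mk ?_ _
    refine (PiLp.continuous_toLp 2 _).comp (continuous_pi fun i => ?_)
    fin_cases i <;> simp <;> fun_prop

theorem quot_isLocalHomeomorph (L : ℝ) : IsLocalHomeomorph (quot L) := by
  have h : quot L = (fun z : Set.Ioi (0 : ℝ) × ℝ × ℝ × ℝ =>
      (z.1, (z.2.1 : AddCircle L), z.2.2)) ∘ coordHomeo := rfl
  rw [h]
  refine IsLocalHomeomorph.comp ?_ coordHomeo.isLocalHomeomorph
  refine IsLocalHomeomorph.mk _ fun z => ?_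
  obtain ⟨e, he, hz⟩ := AddCircle.isLocalHomeomorph_coe L z.2.1
  refine ⟨(OpenPartialHomeomorph.refl _).prod (e.prod (OpenPartialHomeomorph.refl _)), ?_, ?_⟩
  · simp [he]
  · rintro ⟨a, b, c⟩ -
    simp [← hz]

/-- The smooth structure of the compactification: its charts are the local inverses of the
quotient map, read in the coordinates `(t, x¹, x², x³)`. -/
instance (L : ℝ) : ChartedSpace (Model 4) (CKas L) :=
  (quot_isLocalHomeomorph L).chartedSpace (quot_surjective L)

/-! #### Manifolds whose transition maps are locally translations -/

/-- All transition maps of the preferred charts of `M` are locally translations. -/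
def TranslationAtlas (M : Type*) [TopologicalSpace M] [ChartedSpace (Model 4) M] : Prop :=
  ∀ (p q : M) (y : Model 4), y ∈ (extChartAt (𝓡 4) p).target →
    (extChartAt (𝓡 4) p).symm y ∈ (extChartAt (𝓡 4) q).source →
    ∃ c : Model 4, ∀ᶠ z in nhds y, extChartAt (𝓡 4) q ((extChartAt (𝓡 4) p).symm z) = z + c

section TranslationAtlas

variable {M : Type*} [TopologicalSpace M] [ChartedSpace (Model 4) M]

theorem TranslationAtlas.hasMFDerivAt_symm (h : TranslationAtlas M) {p : M} {y : Model 4}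
    (hy : y ∈ (extChartAt (𝓡 4) p).target) :
    HasMFDerivAt (𝓡 4) (𝓡 4) (extChartAt (𝓡 4) p).symm y (ContinuousLinearMap.id ℝ (Model 4)) := by
  obtain ⟨c, hc⟩ := h p ((extChartAt (𝓡 4) p).symm y) y hy (mem_extChartAt_source _)
  refine ⟨continuousAt_extChartAt_symm'' hy, ?_⟩
  have h1 : HasFDerivAt (fun z : Model 4 => z + c) (ContinuousLinearMap.id ℝ (Model 4)) y :=
    (hasFDerivAt_id y).add_const c
  exact (h1.congr_of_eventuallyEq hc).hasFDerivWithinAt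

theorem TranslationAtlas.hasMFDerivAt (h : TranslationAtlas M) {p z : M}
    (hz : z ∈ (extChartAt (𝓡 4) p).source) :
    HasMFDerivAt (𝓡 4) (𝓡 4) (extChartAt (𝓡 4) p) z (ContinuousLinearMap.id ℝ (Model 4)) := by
  obtain ⟨c, hc⟩ := h z p (extChartAt (𝓡 4) z z) (mem_extChartAt_target z)
    (by rwa [extChartAt_to_inv])
  refine ⟨continuousAt_extChartAt' hz, ?_⟩
  have h1 : HasFDerivAt (fun z : Model 4 => z + c) (ContinuousLinearMap.id ℝ (Model 4))
      (extChartAt (𝓡 4) z z) := (hasFDerivAt_id _).add_const c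
  exact (h1.congr_of_eventuallyEq hc).hasFDerivWithinAt

theorem TranslationAtlas.chartVector_const (h : TranslationAtlas M) (v : Model 4) {p : M}
    {y : Model 4} (hy : y ∈ (extChartAt (𝓡 4) p).target) :
    chartVector (fun q : M => (v : TangentSpace (𝓡 4) q)) p y = v := by
  unfold chartVector
  rw [(h.hasMFDerivAt ((extChartAt (𝓡 4) p).map_target hy)).mfderiv]
  rfl

theorem TranslationAtlas.chartComponents (h : TranslationAtlas M)
    (g : ∀ q : M, LinearMap.BilinForm ℝ (TangentSpace (𝓡 4) q)) {p : M}
    {y : Model 4} (hy : y ∈ (extChartAt (𝓡 4) p).target) (i j : Fin 4) :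
    chartComponents g p y i j = g ((extChartAt (𝓡 4) p).symm y) (stdVec i : Model 4)
      (stdVec j : Model 4) := by
  rw [Lorentz.chartComponents, Matrix.of_apply, (h.hasMFDerivAt_symm hy).mfderiv]
  rfl

end TranslationAtlas

theorem kas_target {q : Kas} {y : Model 4} (hy : y ∈ (extChartAt (𝓡 4) q).target) :
    ∃ h : y ∈ halfSpace, (extChartAt (𝓡 4) q).symm y = ⟨y, h⟩ := by
  have h1 := (extChartAt (𝓡 4) q).right_inv hy
  have h2 : ((extChartAt (𝓡 4) q).symm y).1 = y := h1
  exact ⟨h2 ▸ ((extChartAt (𝓡 4) q).symm y).2, Subtype.ext h2⟩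

theorem kas_translationAtlas : TranslationAtlas Kas := by
  intro p q y hy _
  refine ⟨0, ?_⟩
  filter_upwards [(isOpen_extChartAt_target p).mem_nhds hy] with z hz
  rw [add_zero]
  exact (extChartAt (𝓡 4) p).right_inv hz

theorem ckas_target {L : ℝ} {q : CKas L} {y : Model 4} (hy : y ∈ (extChartAt (𝓡 4) q).target) :
    ∃ h : y ∈ halfSpace, (extChartAt (𝓡 4) q).symm y = quot L ⟨y, h⟩ := by
  set x : Kas := (quot_surjective L).hasRightInverse.choose q
  have h0 : (chartAt (Model 4) q) =
      ((quot_isLocalHomeomorph L).localInverseAt x).trans (chartAt (Model 4) x) := rfl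
  rw [extChartAt_target, h0] at hy
  have hy' : y ∈ (extChartAt (𝓡 4) x).target := by
    rw [extChartAt_target]
    simp only [OpenPartialHomeomorph.trans_target] at hy
    simp at hy ⊢
    exact hy.1
  obtain ⟨h, h2⟩ := kas_target hy'
  refine ⟨h, ?_⟩
  rw [← h2]
  have h3 := (quot_isLocalHomeomorph L).localInverseAt_symm (x := x)
  have : (extChartAt (𝓡 4) q).symm y =
    ((quot_isLocalHomeomorph L).localInverseAt x).symm ((extChartAt (𝓡 4) x).symm y) := rfl
  rw [this, h3]

theorem ckas_apply {L : ℝ} {q z : CKas L} (hz : z ∈ (extChartAt (𝓡 4) q).source) :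
    ∃ h : extChartAt (𝓡 4) q z ∈ halfSpace, quot L ⟨extChartAt (𝓡 4) q z, h⟩ = z := by
  have h1 := (extChartAt (𝓡 4) q).map_source hz
  obtain ⟨h, h2⟩ := ckas_target h1
  exact ⟨h, by rw [← h2, (extChartAt (𝓡 4) q).left_inv hz]⟩

theorem quot_eq {L : ℝ} {x y : Kas} (h : quot L x = quot L y) :
    ∃ n : ℤ, x.1 - y.1 = (n * L) • stdVec 1 := by
  simp only [quot, Prod.mk.injEq] at h
  obtain ⟨h0, h1, h2, h3⟩ := h
  replace h0 : x.1 0 = y.1 0 := congrArg Subtype.val h0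
  obtain ⟨n, hn⟩ := (QuotientAddGroup.eq_iff_sub_mem.mp h1)
  refine ⟨n, ?_⟩
  ext i
  fin_cases i <;> simp_all [stdVec]

/-- A continuous map that moves points by multiples of `L` in the first direction is locally a
translation. -/
theorem eventually_translation (L : ℝ) {f : Model 4 → Model 4} {y : Model 4}
    (hf : ContinuousAt f y)
    (h : ∀ᶠ z in nhds y, ∃ n : ℤ, f z - z = (n * L) • stdVec 1) :
    ∀ᶠ z in nhds y, f z = z + (f y - y) := by
  have hc : ContinuousAt (fun z => (f z - z) 1) y := by
    have : ContinuousAt (fun z => f z - z) y := hf.sub continuousAt_id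
    exact (EuclideanSpace.proj (𝕜 := ℝ) (1 : Fin 4)).continuous.continuousAt.comp this
  obtain ⟨n, hn⟩ := h.self_of_nhds
  rcases eq_or_ne L 0 with rfl | hL
  · filter_upwards [h] with z ⟨k, hk⟩
    simp only [mul_zero, zero_smul] at hn hk
    rw [hn, add_zero, ← sub_eq_zero, hk]
  filter_upwards [h, Metric.continuousAt_iff'.mp hc |L| (abs_pos.mpr hL)] with z ⟨k, hk⟩ hz
  have e1 : (f z - z) 1 = k * L := by rw [hk]; simp [stdVec]
  have e2 : (f y - y) 1 = n * L := by rw [hn]; simp [stdVec]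
  rw [Real.dist_eq, e1, e2, ← sub_mul, abs_mul] at hz
  have hz2 : |((k - n : ℤ) : ℝ)| < 1 := by
    push_cast
    exact (mul_lt_iff_lt_one_left (abs_pos.mpr hL)).mp hz
  have hkn : k - n = 0 := by
    rw [← Int.cast_abs] at hz2
    exact Int.abs_lt_one_iff.mp (by exact_mod_cast hz2)
  obtain rfl : k = n := by omega
  rw [hn, ← hk]; abel

theorem ckas_translationAtlas (L : ℝ) : TranslationAtlas (CKas L) := by
  intro p q y hy hq
  refine ⟨_, eventually_translation L (f := fun z => extChartAt (𝓡 4) q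
    ((extChartAt (𝓡 4) p).symm z)) ?_ ?_⟩
  · exact ContinuousAt.comp (continuousAt_extChartAt' hq) (continuousAt_extChartAt_symm'' hy)
  · filter_upwards [(isOpen_extChartAt_target p).mem_nhds hy,
      (continuousAt_extChartAt_symm'' hy).preimage_mem_nhds
        ((isOpen_extChartAt_source q).mem_nhds hq)] with z hz1 hz2
    obtain ⟨h1, e1⟩ := ckas_target hz1
    obtain ⟨h2, e2⟩ := ckas_apply hz2
    exact quot_eq (e2.trans e1)

theorem TranslationAtlas.isManifold {M : Type*} [TopologicalSpace M] [ChartedSpace (Model 4) M]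
    (h : TranslationAtlas M) (h' : ∀ e ∈ atlas (Model 4) M, ∃ p, e = chartAt (Model 4) p) :
    IsManifold (𝓡 4) ∞ M := by
  refine isManifold_of_contDiffOn _ _ _ fun e e' he he' => ?_
  obtain ⟨p, rfl⟩ := h' e he
  obtain ⟨q, rfl⟩ := h' e' he'
  intro y hy
  obtain ⟨c, hc⟩ := h p q y (by simpa using hy.1.1) (by simpa using hy.1.2)
  exact ((contDiffAt_id.add contDiffAt_const).congr_of_eventuallyEq hc).contDiffWithinAt

instance (L : ℝ) : IsManifold (𝓡 4) ∞ (CKas L) :=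
  (ckas_translationAtlas L).isManifold fun _ ⟨p, hp⟩ => ⟨p, hp.symm⟩

/-! #### The metrics -/

/-- The bilinear form `-dt² + ∑ⱼ t^{2pⱼ} (dxʲ)²` at time `t`. -/
def kasnerForm (p : Fin 3 → ℝ) (t : ℝ) : LinearMap.BilinForm ℝ (Model 4) :=
  LinearMap.mk₂ ℝ (fun v w => -(v 0 * w 0) + ∑ j : Fin 3, t ^ (2 * p j) * (v j.succ * w j.succ))
    (by intros; simp [Fin.sum_univ_succ]; ring) (by intros; simp [Fin.sum_univ_succ]; ring)
    (by intros; simp [Fin.sum_univ_succ]; ring) (by intros; simp [Fin.sum_univ_succ]; ring)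

/-- The Kasner metric. -/
def kasMetric (p : Fin 3 → ℝ) (q : Kas) : LinearMap.BilinForm ℝ (TangentSpace (𝓡 4) q) :=
  kasnerForm p (q.1 0)

/-- The metric of the compactification. -/
def ckasMetric (p : Fin 3 → ℝ) (L : ℝ) (q : CKas L) :
    LinearMap.BilinForm ℝ (TangentSpace (𝓡 4) q) :=
  kasnerForm p q.1

theorem kasnerForm_apply (p : Fin 3 → ℝ) (t : ℝ) (v w : Model 4) :
    kasnerForm p t v w = -(v 0 * w 0) + ∑ j : Fin 3, t ^ (2 * p j) * (v j.succ * w j.succ) := rfl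

theorem kasnerForm_comm (p : Fin 3 → ℝ) (t : ℝ) (v w : Model 4) :
    kasnerForm p t v w = kasnerForm p t w v := by
  simp only [kasnerForm_apply, mul_comm]

theorem kasnerForm_time (p : Fin 3 → ℝ) (t : ℝ) :
    kasnerForm p t (stdVec 0) (stdVec 0) < 0 := by
  simp [kasnerForm_apply, stdVec]

theorem kasnerForm_pos (p : Fin 3 → ℝ) {t : ℝ} (ht : 0 < t) (v : Model 4)
    (hv : kasnerForm p t (stdVec 0) v = 0) (hv0 : v ≠ 0) : 0 < kasnerForm p t v v := by
  have h0 : v 0 = 0 := by simpa [kasnerForm_apply, stdVec] using hv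
  rw [kasnerForm_apply, h0, mul_zero, neg_zero, zero_add]
  have hnn : ∀ j : Fin 3, 0 ≤ t ^ (2 * p j) * (v j.succ * v j.succ) := fun j =>
    mul_nonneg (Real.rpow_pos_of_pos ht _).le (mul_self_nonneg _)
  refine lt_of_le_of_ne (Finset.sum_nonneg fun j _ => hnn j) fun he => hv0 ?_
  have hz := (Finset.sum_eq_zero_iff_of_nonneg fun j _ => hnn j).mp he.symm
  ext i
  refine Fin.cases h0 (fun j => ?_) i
  have := hz j (Finset.mem_univ j)
  simpa [(Real.rpow_pos_of_pos ht (2 * p j)).ne'] using this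

theorem kasnerForm_smooth (p : Fin 3 → ℝ) (v w : Model 4) :
    ContDiffOn ℝ ∞ (fun y : Model 4 => kasnerForm p (y 0) v w) halfSpace := by
  simp only [kasnerForm_apply]
  refine contDiffOn_const.add (ContDiffOn.sum fun j _ => ContDiffOn.mul ?_ contDiffOn_const)
  refine ContDiffOn.rpow_const_of_ne ?_ fun y hy => (show 0 < y 0 from hy).ne'
  exact (EuclideanSpace.proj (𝕜 := ℝ) (0 : Fin 4)).contDiff.contDiffOn

/-- Kasner spacetime with exponents `p`: the manifold `{t > 0}` with the metric
`-dt² + ∑ⱼ t^{2pⱼ} (dxʲ)²`, time oriented by `∂_t`. -/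
def kasner (p : Fin 3 → ℝ) : Spacetime 4 Kas where
  isManifold := inferInstance
  t2Space := inferInstance
  secondCountable := inferInstance
  metric := kasMetric p
  time _ := (stdVec 0 : Model 4)
  metric_symm q := kasnerForm_comm p (q.1 0)
  metric_smooth q i j := by
    refine ((kasnerForm_smooth p (stdVec i) (stdVec j)).mono fun y hy =>
      (kas_target hy).1).congr fun y hy => ?_
    refine (kas_translationAtlas.chartComponents _ hy i j).trans ?_
    rw [(kas_target hy).2]
    rfl
  time_smooth q := contDiffOn_const.congr fun y hy =>
    kas_translationAtlas.chartVector_const (stdVec 0) hy.1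
  time_timelike q := kasnerForm_time p (q.1 0)
  orthogonal_pos q := kasnerForm_pos p q.2

/-- The compactified Kasner spacetime, `x¹ ∼ x¹ + L`: in the charts given by the coordinates
`(t, x¹, x², x³)`, it has the metric and the time orientation of Kasner spacetime. -/
def cKasner (p : Fin 3 → ℝ) (L : ℝ) : Spacetime 4 (CKas L) where
  isManifold := inferInstance
  t2Space := inferInstance
  secondCountable := inferInstance
  metric := ckasMetric p L
  time _ := (stdVec 0 : Model 4)
  metric_symm q := kasnerForm_comm p q.1
  metric_smooth q i j := by
    refine ((kasnerForm_smooth p (stdVec i) (stdVec j)).mono fun y hy =>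
      (ckas_target hy).1).congr fun y hy => ?_
    refine ((ckas_translationAtlas L).chartComponents _ hy i j).trans ?_
    rw [(ckas_target hy).2]
    rfl
  time_smooth q := contDiffOn_const.congr fun y hy =>
    (ckas_translationAtlas L).chartVector_const (stdVec 0) hy.1
  time_timelike q := kasnerForm_time p q.1
  orthogonal_pos q := kasnerForm_pos p q.1.2

/-- The quotient map is a local diffeomorphism whose derivative is the identity in the coordinates
`(t, x¹, x², x³)`. -/
theorem hasMFDerivAt_quot (L : ℝ) (x : Kas) :
    HasMFDerivAt (𝓡 4) (𝓡 4) (quot L) x (ContinuousLinearMap.id ℝ (Model 4)) := by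
  have hy : extChartAt (𝓡 4) x x ∈ (extChartAt (𝓡 4) x).target := mem_extChartAt_target x
  have hcont : Continuous (quot L) := (quot_isLocalHomeomorph L).continuous
  have hc1 : ContinuousAt (fun z => quot L ((extChartAt (𝓡 4) x).symm z))
      (extChartAt (𝓡 4) x x) :=
    hcont.continuousAt.comp (continuousAt_extChartAt_symm'' hy)
  have hq : quot L ((extChartAt (𝓡 4) x).symm (extChartAt (𝓡 4) x x)) = quot L x := by
    rw [extChartAt_to_inv]
  have hs : (extChartAt (𝓡 4) (quot L x)).source ∈
      nhds (quot L ((extChartAt (𝓡 4) x).symm (extChartAt (𝓡 4) x x))) := by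
    rw [hq]; exact extChartAt_source_mem_nhds _
  refine ⟨hcont.continuousAt, ?_⟩
  have key := eventually_translation L (y := extChartAt (𝓡 4) x x)
    (f := fun z => extChartAt (𝓡 4) (quot L x) (quot L ((extChartAt (𝓡 4) x).symm z)))
    (ContinuousAt.comp (by rw [hq]; exact continuousAt_extChartAt _) hc1) (by
      filter_upwards [(isOpen_extChartAt_target x).mem_nhds hy,
        hc1.preimage_mem_nhds hs] with z hz1 hz2
      obtain ⟨h1, e1⟩ := kas_target hz1
      obtain ⟨h2, e2⟩ := ckas_apply hz2
      exact quot_eq (e2.trans (congrArg (quot L) e1)))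
  exact (((hasFDerivAt_id _).add_const _).congr_of_eventuallyEq key).hasFDerivWithinAt

/-- The quotient map from Kasner spacetime to its compactification is a local isometry. -/
theorem quot_isometry (p : Fin 3 → ℝ) (L : ℝ) (x : Kas) (v w : TangentSpace (𝓡 4) x) :
    (cKasner p L).metric (quot L x) (mfderiv (𝓡 4) (𝓡 4) (quot L) x v)
      (mfderiv (𝓡 4) (𝓡 4) (quot L) x w) = (kasner p).metric x v w := by
  rw [(hasMFDerivAt_quot L x).mfderiv]
  rfl

/-- The function `x¹ - t^{1-p₁} / (1-p₁)` on Kasner spacetime. -/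
def eikonal (p : Fin 3 → ℝ) (q : Kas) : ℝ :=
  q.1 1 - (q.1 0) ^ (1 - p 0) / (1 - p 0)

end Kasner

end

open scoped Manifold ContDiff

noncomputable section

/-! ### Kasner exponents -/

namespace Kasner

/-! A maximum principle excludes trapped submanifolds. Let `F` have negative derivative along future
timelike vectors. On a closed spacelike submanifold `F` has a maximum; there `dF` kills the tangent
space and the Hessian of the restriction is negative semidefinite. The chain rule gives `∂_α∂_β(F ∘
ψ) = Hess F(e_α, e_β) + dF(∇_{e_α} e_β)`. Taking the trace with `h^{αβ}` yields `dF(H) = tr Hess F -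
tr ∂∂(F ∘ ψ)`. If the trace of `Hess F` is nonnegative on spacelike `k`-planes in `ker dF`, then
`dF(H) ≥ 0`, so `H` is not future timelike. This is `IsLocallyKasner.not_isClosedTrapped`, used with
two functions.

On Kasner spacetime `F` is the eikonal function. On `ker dF` the terms of its Hessian in the
contracting direction `x¹` cancel (`hess_eikonalCoord`). What remains is a sum of squares weighted
by the two positive exponents, which gives both convex null level sets and the exclusion in every
dimension. The function involves `x¹` itself, so it does not descend to the compactification.

On c-Kasner spacetime `F = -t` is still available. Its Hessian on a slice is the second fundamental
form, with principal curvatures `pⱼ/t`. The trace over a plane is at least `(p₁ + p₂)/t = (1 - p₃)/t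
> 0`, and over the whole slice it is `1/t`, while in the direction of `x¹` it is `p₁/t < 0`
(`sum_inv_mul_sliceForm_nonneg`, `not_isKFutureConvex_one_slice`). So there are no closed trapped
surfaces, but the `x¹`-loops, once closed up, have `H = -(p₁/t) ∂_t`, which is future timelike
(`normalTrace_loop`).

All local computations are made once, for spacetimes satisfying `IsLocallyKasner`: their charts
differ by translations, under which the coordinate vectors and the time coordinate make global sense
or are controlled by the metric's dependence on `t` alone. -/

/-- If all exponents were nonnegative, the nonnegative numbers `pⱼ - pⱼ²` would sum to `0`, so every
`pⱼ` would be `0` or `1`, and the order would leave only the excluded flat case. The lower bound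
comes from `(p₂ + p₃)² ≤ 2 (p₂² + p₃²)`. The two sum conditions make the pairwise products add up to
`0`, whence `p₂ (1 - p₂) = -p₁ p₃ > 0`. -/
theorem exponent_bounds {p : Fin 3 → ℝ} (hsum : ∑ j, p j = 1) (hsq : ∑ j, p j ^ 2 = 1)
    (hord : p 0 ≤ p 1 ∧ p 1 ≤ p 2) (hflat : p ≠ ![0, 0, 1]) :
    -(1 / 3) ≤ p 0 ∧ p 0 < 0 ∧ 0 < p 1 ∧ p 2 < 1 := by
  simp only [Fin.sum_univ_three] at hsum hsq
  obtain ⟨h01, h12⟩ := hord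
  have h2 : p 2 ≤ 1 := by nlinarith [sq_nonneg (p 0), sq_nonneg (p 1)]
  have h0 : p 0 < 0 := by
    by_contra! h
    have h1 : 0 ≤ p 1 := h.trans h01
    have e0 : p 0 * (1 - p 0) = 0 := by nlinarith
    have e1 : p 1 * (1 - p 1) = 0 := by nlinarith
    have e0' : p 0 = 0 := by
      rcases mul_eq_zero.mp e0 with h' | h'
      · exact h'
      · nlinarith
    have e1' : p 1 = 0 := by
      rcases mul_eq_zero.mp e1 with h' | h'
      · exact h'
      · nlinarith
    refine hflat (funext fun i => ?_)
    fin_cases i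
    · exact e0'
    · exact e1'
    · show p 2 = 1
      linarith
  have h2' : p 2 < 1 := by nlinarith [sq_nonneg (p 1)]
  have h2'' : 0 < p 2 := by nlinarith
  refine ⟨by nlinarith [sq_nonneg (p 1 - p 2)], h0, ?_, h2'⟩
  have e : p 1 * (1 - p 1) = -(p 0) * p 2 := by
    have : (p 0 + p 1 + p 2) ^ 2 = 1 := by rw [hsum]; norm_num
    have e' : p 0 = 1 - p 1 - p 2 := by linarith
    rw [e'] at this hsq ⊢
    nlinarith
  nlinarith [mul_pos (neg_pos.mpr h0) h2'']

end Kasner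

/-! ### Traces with respect to a positive definite matrix -/

namespace Matrix

/-- Writing `A = BᵀB` turns the trace into a sum over the rows of `B` of values of the quadratic
form of `Q`. With `A` an inverse Gram matrix, this passes from semidefiniteness to the sign of a
trace without choosing an orthonormal basis. -/
theorem PosDef.sum_mul_nonneg {k : ℕ} {A : Matrix (Fin k) (Fin k) ℝ} (hA : A.PosDef)
    {Q : Fin k → Fin k → ℝ} (hQ : ∀ c : Fin k → ℝ, 0 ≤ ∑ α, ∑ β, c α * c β * Q α β) :
    0 ≤ ∑ α, ∑ β, A α β * Q α β := by
  open scoped MatrixOrder in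
  obtain ⟨B, rfl⟩ := CStarAlgebra.nonneg_iff_eq_star_mul_self.mp hA.posSemidef.nonneg
  have h : ∑ α, ∑ β, (star B * B) α β * Q α β
      = ∑ γ, ∑ α, ∑ β, B γ α * B γ β * Q α β := by
    simp only [Matrix.mul_apply, Matrix.star_apply, star_trivial, Finset.sum_mul]
    rw [Finset.sum_comm_cycle]
  rw [h]
  exact Finset.sum_nonneg fun γ _ => hQ (B γ)

/-- The diagonal entries of the projection `Uᵀ (U Uᵀ)⁻¹ U` onto the row space of `U` are at most
`1`, and they sum to the number of rows. -/
theorem PosDef.projection_diag {k n : ℕ} (U : Matrix (Fin k) (Fin n) ℝ) (h : (U * Uᵀ).PosDef) :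
    (∀ j, ∑ α, ∑ β, (U * Uᵀ)⁻¹ α β * (U α j * U β j) ≤ 1) ∧
      ∑ j, ∑ α, ∑ β, (U * Uᵀ)⁻¹ α β * (U α j * U β j) = k := by
  set A := (U * Uᵀ)⁻¹
  have hu : IsUnit (U * Uᵀ).det := (Matrix.isUnit_iff_isUnit_det _).mp h.isUnit
  have hA : A * (U * Uᵀ) = 1 := Matrix.nonsing_inv_mul _ hu
  have hAt : Aᵀ = A := by
    rw [Matrix.transpose_nonsing_inv, Matrix.transpose_mul, Matrix.transpose_transpose]
  set Q := Uᵀ * (A * U)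
  have hd : ∀ j, ∑ α, ∑ β, A α β * (U α j * U β j) = Q j j := by
    intro j
    simp only [Q, Matrix.mul_apply, Matrix.transpose_apply, Finset.mul_sum]
    exact Finset.sum_congr rfl fun α _ => Finset.sum_congr rfl fun β _ => by ring
  have hQQ : Q * Q = Q := by
    have : Q * Q = Uᵀ * ((A * (U * Uᵀ)) * (A * U)) := by
      simp only [Q, Matrix.mul_assoc]
    rw [this, hA, Matrix.one_mul]
  have hQt : Qᵀ = Q := by
    simp only [Q, Matrix.transpose_mul, Matrix.transpose_transpose, hAt, Matrix.mul_assoc]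
  simp only [hd]
  constructor
  · intro j
    -- A symmetric idempotent satisfies `Q j j = ∑ i, (Q j i)² ≥ (Q j j)²`, hence `Q j j ≤ 1`.
    have h1 : Q j j = ∑ i, Q j i * Q j i := by
      conv_lhs => rw [← hQQ, Matrix.mul_apply]
      exact Finset.sum_congr rfl fun i _ => congrArg (Q j i * ·) (congrFun (congrFun hQt j) i)
    have h2 : Q j j * Q j j ≤ Q j j := by
      conv_rhs => rw [h1]
      exact Finset.single_le_sum (f := fun i => Q j i * Q j i)
        (fun i _ => mul_self_nonneg _) (Finset.mem_univ j)
    nlinarith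
  · have : ∑ j, Q j j = Q.trace := rfl
    rw [this]
    simp only [Q]
    rw [Matrix.trace_mul_comm, Matrix.mul_assoc, hA, Matrix.trace_one, Fintype.card_fin]

end Matrix

/-! ### The second derivative test -/

/-- At a local maximum, the Hessian is negative semidefinite. -/
theorem IsLocalMax.fderiv_fderiv_nonpos {E : Type*} [NormedAddCommGroup E] [NormedSpace ℝ E]
    {K : E → ℝ} {x : E} (hmax : IsLocalMax K x) (hK : ContDiffAt ℝ 2 K x) (u : E) :
    fderiv ℝ (fderiv ℝ K) x u u ≤ 0 := by
  set γ : ℝ → E := fun s => x + s • u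
  have hγ : ∀ s, HasDerivAt γ u s := fun s => by
    simpa only [one_smul, id] using ((hasDerivAt_id s).smul_const u).const_add x
  have hγ0 : γ 0 = x := by simp [γ]
  have hγc : ContinuousAt γ 0 := (hγ 0).continuousAt
  have hdiff : ∀ᶠ z in nhds x, DifferentiableAt ℝ K z :=
    (hK.eventually (by simp)).mono fun z hz => hz.differentiableAt (by simp)
  have h1 : deriv (fun s => K (γ s)) =ᶠ[nhds 0] fun s => fderiv ℝ K (γ s) u := by
    rw [← hγ0] at hdiff
    filter_upwards [hγc.eventually hdiff] with s hs
    exact (hs.hasFDerivAt.comp_hasDerivAt s (hγ s)).deriv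
  have h2 : deriv (deriv fun s => K (γ s)) 0 = fderiv ℝ (fderiv ℝ K) x u u := by
    rw [h1.deriv_eq]
    have hd : DifferentiableAt ℝ (fderiv ℝ K) (γ 0) := by
      rw [hγ0]
      exact (hK.fderiv_right (m := 1) (by norm_num)).differentiableAt (by simp)
    have := (hd.hasFDerivAt.comp_hasDerivAt 0 (hγ 0)).clm_apply (hasDerivAt_const (0 : ℝ) u)
    rw [hγ0] at this
    simpa using this.deriv
  have hmaxγ : IsLocalMax (fun s => K (γ s)) 0 := by
    have : ∀ᶠ z in nhds (γ 0), K z ≤ K x := by rw [hγ0]; exact hmax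
    filter_upwards [hγc.eventually this] with s hs
    simpa only [hγ0] using hs
  -- A positive second derivative would make `0` a local minimum along the line as well as a
  -- maximum. The function would then be locally constant on the line, with vanishing second
  -- derivative.
  by_contra! hpos
  have hmin : IsLocalMin (fun s => K (γ s)) 0 :=
    isLocalMin_of_deriv_deriv_pos (by rw [h2]; exact hpos) hmaxγ.deriv_eq_zero
      (ContinuousAt.comp (by rw [hγ0]; exact hK.continuousAt) hγc)
  have hconst : (fun s => K (γ s)) =ᶠ[nhds 0] fun _ => K (γ 0) := by
    filter_upwards [hmaxγ, hmin] with s hs1 hs2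
    exact le_antisymm hs1 hs2
  have hz : deriv (deriv fun s => K (γ s)) 0 = 0 := by
    rw [hconst.deriv.deriv_eq]
    simp
  rw [h2] at hz
  exact hpos.ne' hz

/-- The second derivative of a composition. -/
theorem fderiv_fderiv_comp {E F : Type*} [NormedAddCommGroup E] [NormedSpace ℝ E]
    [NormedAddCommGroup F] [NormedSpace ℝ F] {f : F → ℝ} {g : E → F} {x : E}
    (hf : ContDiffAt ℝ 2 f (g x)) (hg : ContDiffAt ℝ 2 g x) (u v : E) :
    fderiv ℝ (fderiv ℝ (f ∘ g)) x u v =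
      fderiv ℝ (fderiv ℝ f) (g x) (fderiv ℝ g x u) (fderiv ℝ g x v)
        + fderiv ℝ f (g x) (fderiv ℝ (fderiv ℝ g) x u v) := by
  have hf' : ∀ᶠ z in nhds (g x), DifferentiableAt ℝ f z :=
    (hf.eventually (by simp)).mono fun z hz => hz.differentiableAt (by simp)
  have hg' : ∀ᶠ z in nhds x, DifferentiableAt ℝ g z :=
    (hg.eventually (by simp)).mono fun z hz => hz.differentiableAt (by simp)
  have h1 : fderiv ℝ (f ∘ g) =ᶠ[nhds x] fun z => (fderiv ℝ f (g z)).comp (fderiv ℝ g z) := by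
    filter_upwards [hg.continuousAt.eventually hf', hg'] with z h1 h2
    exact fderiv_comp z h1 h2
  rw [h1.fderiv_eq]
  have hfd : DifferentiableAt ℝ (fderiv ℝ f) (g x) :=
    (hf.fderiv_right (m := 1) (by norm_num)).differentiableAt (by simp)
  have hgd : DifferentiableAt ℝ (fderiv ℝ g) x :=
    (hg.fderiv_right (m := 1) (by norm_num)).differentiableAt (by simp)
  have h2 := (hfd.hasFDerivAt.comp x hg'.self_of_nhds.hasFDerivAt).clm_comp hgd.hasFDerivAt
  have h3 := h2.fderiv
  simp only [Function.comp_def] at h3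
  rw [h3]
  simp [add_comm]

/-! ### Locality of the Christoffel symbols and of the Ricci tensor -/

namespace Lorentz

open Filter

variable {m : ℕ} {G G' : Model m → Matrix (Fin m) (Fin m) ℝ} {y : Model m}

theorem pderiv_congr {F : Type*} [NormedAddCommGroup F] [NormedSpace ℝ F] {f f' : Model m → F}
    (h : f =ᶠ[nhds y] f') (i : Fin m) : pderiv i f y = pderiv i f' y := by
  rw [pderiv, pderiv, h.fderiv_eq]

/-- Metric components in a chart are controlled only on the chart target. Since the symbols involve
derivatives, agreement of germs, not of values, is what transfers the explicit formulas. -/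
theorem christoffel_congr (h : G =ᶠ[nhds y] G') (c a b : Fin m) :
    christoffel G c a b y = christoffel G' c a b y := by
  have h' : ∀ i j, (fun z => G z i j) =ᶠ[nhds y] fun z => G' z i j := fun i j =>
    h.mono fun z hz => congrFun (congrFun hz i) j
  simp only [christoffel, h.self_of_nhds, pderiv_congr (h' _ _)]

theorem christoffel_eventually_congr (h : G =ᶠ[nhds y] G') (c a b : Fin m) :
    christoffel G c a b =ᶠ[nhds y] christoffel G' c a b :=
  (eventually_eventually_nhds.mpr h).mono fun _ hz => christoffel_congr hz c a b

theorem christoffelVec_congr (h : G =ᶠ[nhds y] G') (v w : Model m) :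
    christoffelVec G y v w = christoffelVec G' y v w := by
  simp only [christoffelVec, christoffel_congr h]

theorem ricci_congr (h : G =ᶠ[nhds y] G') (b d : Fin m) : ricci G b d y = ricci G' b d y := by
  simp only [ricci, christoffel_congr h, pderiv_congr (christoffel_eventually_congr h _ _ _)]

theorem christoffelVec_apply (G : Model m → Matrix (Fin m) (Fin m) ℝ) (y v w : Model m)
    (c : Fin m) : christoffelVec G y v w c = ∑ a, ∑ b, christoffel G c a b y * v a * w b := by
  simp [christoffelVec, stdVec, Finset.sum_apply, Pi.single_apply]

theorem stdVec_apply (i j : Fin m) : (stdVec i : Model m) j = if j = i then 1 else 0 := by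
  simp [stdVec]

/-- The partial derivatives of a function of one coordinate. -/
theorem pderiv_comp_coord {f : ℝ → ℝ} {f' : ℝ} (k : Fin m) (hf : HasDerivAt f f' (y k))
    (i : Fin m) : pderiv i (fun z : Model m => f (z k)) y = if i = k then f' else 0 := by
  have h1 : HasFDerivAt (fun z : Model m => z k) (EuclideanSpace.proj (𝕜 := ℝ) k) y :=
    (EuclideanSpace.proj (𝕜 := ℝ) k).hasFDerivAt
  have := hf.comp_hasFDerivAt y h1
  rw [pderiv, show (fun z : Model m => f (z k)) = f ∘ fun z : Model m => z k from rfl, this.fderiv]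
  simp [stdVec_apply, eq_comm]

end Lorentz

/-! ### The Kasner metric in coordinates -/

namespace Kasner

open Lorentz Filter

variable {p : Fin 3 → ℝ}

/-- The diagonal entries of the Kasner metric at time `t`. -/
def metricDiag (p : Fin 3 → ℝ) (t : ℝ) : Fin 4 → ℝ :=
  Fin.cons (-1) fun j => t ^ (2 * p j)

/-- The component matrix of the Kasner metric. -/
def metricMatrix (p : Fin 3 → ℝ) (y : Model 4) : Matrix (Fin 4) (Fin 4) ℝ :=
  Matrix.diagonal (metricDiag p (y 0))

theorem kasnerForm_stdVec (p : Fin 3 → ℝ) (t : ℝ) (i j : Fin 4) :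
    kasnerForm p t (stdVec i) (stdVec j) = Matrix.diagonal (metricDiag p t) i j := by
  have h2 : metricDiag p t 2 = t ^ (2 * p 1) := rfl
  have h3 : metricDiag p t 3 = t ^ (2 * p 2) := rfl
  rw [kasnerForm_apply, Fin.sum_univ_three]
  fin_cases i <;> fin_cases j <;> simp [stdVec_apply, h2, h3]
  all_goals simp [metricDiag]

/-- The exponents extended by `0` in the time direction. -/
def exponent (p : Fin 3 → ℝ) : Fin 4 → ℝ := Fin.cons 0 p

/-- The Christoffel symbols of the Kasner metric at time `t`. -/
def gamma (p : Fin 3 → ℝ) (c a b : Fin 4) (t : ℝ) : ℝ :=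
  ((if a = 0 ∧ c = b then 1 else 0) + if b = 0 ∧ c = a then 1 else 0) * (exponent p c / t)
    + (if c = 0 ∧ a = b then 1 else 0) * (exponent p a * (t ^ (2 * exponent p a) / t))

theorem hasDerivAt_metricDiag {t : ℝ} (ht : 0 < t) (c : Fin 4) :
    HasDerivAt (fun t => metricDiag p t c) (2 * exponent p c * (metricDiag p t c / t)) t := by
  refine Fin.cases ?_ (fun j => ?_) c
  · simpa [metricDiag, exponent] using hasDerivAt_const t (-1 : ℝ)
  · have := Real.hasDerivAt_rpow_const (x := t) (p := 2 * p j) (Or.inl ht.ne')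
    rw [Real.rpow_sub_one ht.ne'] at this
    simpa [metricDiag, exponent] using this

theorem metricDiag_ne_zero {t : ℝ} (ht : 0 < t) (c : Fin 4) : metricDiag p t c ≠ 0 := by
  refine Fin.cases ?_ (fun j => ?_) c
  · simp [metricDiag]
  · simpa [metricDiag] using (Real.rpow_pos_of_pos ht _).ne'

theorem pderiv_metricMatrix {y : Model 4} (hy : 0 < y 0) (i c d : Fin 4) :
    pderiv i (fun z => metricMatrix p z c d) y =
      if i = 0 ∧ c = d then 2 * exponent p c * (metricDiag p (y 0) c / y 0) else 0 := by
  rcases eq_or_ne c d with rfl | hcd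
  · simp only [metricMatrix, Matrix.diagonal_apply_eq, and_true]
    exact pderiv_comp_coord 0 (hasDerivAt_metricDiag hy c) i
  · simp [metricMatrix, hcd, pderiv]

theorem christoffel_metricMatrix {y : Model 4} (hy : 0 < y 0) (c a b : Fin 4) :
    christoffel (metricMatrix p) c a b y = gamma p c a b (y 0) := by
  have hinv : (metricMatrix p y)⁻¹ = Matrix.diagonal fun c => (metricDiag p (y 0) c)⁻¹ := by
    refine Matrix.inv_eq_left_inv ?_
    rw [metricMatrix, Matrix.diagonal_mul_diagonal, ← Matrix.diagonal_one]
    congr 1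
    funext c
    exact inv_mul_cancel₀ (metricDiag_ne_zero hy c)
  simp only [christoffel, hinv, pderiv_metricMatrix hy]
  rw [Finset.sum_eq_single c (fun d _ hd => by simp [hd.symm]) (by simp),
    Matrix.diagonal_apply_eq]
  have hc := metricDiag_ne_zero (p := p) hy c
  have h0 : metricDiag p (y 0) 0 = -1 := rfl
  -- The time entry is `-1`, not `t⁰ = 1`; the factor `exponent p 0 = 0` makes the difference
  -- harmless.
  have hs : exponent p a * metricDiag p (y 0) a = exponent p a * y 0 ^ (2 * exponent p a) := by
    refine Fin.cases ?_ (fun j => ?_) a <;> simp [exponent, metricDiag]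
  have key : (metricDiag p (y 0) c)⁻¹ *
      (if c = 0 ∧ a = b then 2 * exponent p a * (metricDiag p (y 0) a / y 0) else 0)
      = -2 * ((if c = 0 ∧ a = b then 1 else 0) *
        (exponent p a * (y 0 ^ (2 * exponent p a) / y 0))) := by
    split_ifs with h
    · rw [h.1, h0, ← mul_div_assoc, ← mul_div_assoc, mul_assoc, hs]
      norm_num
      ring
    · simp
  have key2 : ∀ (P : Prop) [Decidable P], (metricDiag p (y 0) c)⁻¹ *
      (if P then 2 * exponent p c * (metricDiag p (y 0) c / y 0) else 0)
      = 2 * ((if P then 1 else 0) * (exponent p c / y 0)) := by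
    intro P _
    split_ifs
    · field_simp
    · simp
  rw [gamma, mul_sub, mul_add, key2, key2, key]
  ring

theorem hasDerivAt_gamma {t : ℝ} (ht : 0 < t) (c a b : Fin 4) :
    HasDerivAt (gamma p c a b)
      (-((if a = 0 ∧ c = b then 1 else 0) + if b = 0 ∧ c = a then 1 else 0)
          * (exponent p c / t ^ 2)
        + (if c = 0 ∧ a = b then 1 else 0) *
          (exponent p a * ((2 * exponent p a - 1) * t ^ (2 * exponent p a) / t ^ 2))) t := by
  have h1 : HasDerivAt (fun t => exponent p c / t) (-(exponent p c / t ^ 2)) t := by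
    have := (hasDerivAt_inv ht.ne').const_mul (exponent p c)
    simpa only [div_eq_mul_inv, mul_neg] using this
  have h2 : HasDerivAt (fun t => exponent p a * (t ^ (2 * exponent p a) / t))
      (exponent p a * ((2 * exponent p a - 1) * t ^ (2 * exponent p a) / t ^ 2)) t := by
    have h3 := Real.hasDerivAt_rpow_const (x := t) (p := 2 * exponent p a) (Or.inl ht.ne')
    rw [Real.rpow_sub_one ht.ne'] at h3
    have h4 := (h3.div (hasDerivAt_id t) ht.ne').const_mul (exponent p a)
    refine h4.congr_deriv ?_
    simp only [id]
    field_simp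
  refine ((h1.const_mul _).add (h2.const_mul _)).congr_deriv ?_
  ring

/-- Only diagonal components survive: `R_tt = (∑ pⱼ - ∑ pⱼ²) / t²` and `R_jj = pⱼ t^{2pⱼ-2} (∑ pᵢ -
1)`. The Kasner conditions are exactly their vanishing for nonzero exponents. -/
theorem ricci_metricMatrix (hsum : ∑ j, p j = 1) (hsq : ∑ j, p j ^ 2 = 1) {y : Model 4}
    (hy : 0 < y 0) (b d : Fin 4) : ricci (metricMatrix p) b d y = 0 := by
  have hev : ∀ c a b, christoffel (metricMatrix p) c a b =ᶠ[nhds y]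
      fun z => gamma p c a b (z 0) := fun c a b => by
    have : {z : Model 4 | 0 < z 0} ∈ nhds y := halfSpace.2.mem_nhds hy
    filter_upwards [this] with z hz
    exact christoffel_metricMatrix hz c a b
  simp only [ricci, christoffel_metricMatrix hy, pderiv_congr (hev _ _ _),
    pderiv_comp_coord 0 (hasDerivAt_gamma hy _ _ _)]
  rw [Fin.sum_univ_three] at hsum hsq
  have h2 : p 2 = 1 - p 0 - p 1 := by linarith
  have hsq' : p 0 ^ 2 + p 1 ^ 2 = p 0 + p 1 - p 0 * p 1 := by rw [h2] at hsq; nlinarith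
  simp only [Fin.sum_univ_four, gamma]
  have e0 : exponent p 0 = 0 := rfl
  have e1 : exponent p 1 = p 0 := rfl
  have e2 : exponent p 2 = p 1 := rfl
  have e3 : exponent p 3 = p 2 := rfl
  fin_cases b <;> fin_cases d <;> simp [e0, e1, e2, e3]
  · linear_combination (hsum - hsq) / y 0 ^ 2
  · linear_combination (p 0 * y 0 ^ (2 * p 0) / y 0 ^ 2) * hsum
  · linear_combination (p 1 * y 0 ^ (2 * p 1) / y 0 ^ 2) * hsum
  · linear_combination (p 2 * y 0 ^ (2 * p 2) / y 0 ^ 2) * hsum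

theorem christoffelVec_zero {y : Model 4} (hy : 0 < y 0) (v w : Model 4) :
    christoffelVec (metricMatrix p) y v w 0 =
      ∑ j : Fin 3, p j * (y 0 ^ (2 * p j) / y 0) * (v j.succ * w j.succ) := by
  simp only [christoffelVec_apply, christoffel_metricMatrix hy]
  have e1 : exponent p 1 = p 0 := rfl
  have e2 : exponent p 2 = p 1 := rfl
  have e3 : exponent p 3 = p 2 := rfl
  have e0 : exponent p 0 = 0 := rfl
  have s1 : Fin.succ (1 : Fin 3) = 2 := rfl
  have s2 : Fin.succ (2 : Fin 3) = 3 := rfl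
  simp [Fin.sum_univ_four, Fin.sum_univ_three, gamma, e0, e1, e2, e3, s1, s2]
  ring

theorem christoffelVec_succ {y : Model 4} (hy : 0 < y 0) (v w : Model 4) (j : Fin 3) :
    christoffelVec (metricMatrix p) y v w j.succ =
      p j / y 0 * (v 0 * w j.succ + v j.succ * w 0) := by
  simp only [christoffelVec_apply, christoffel_metricMatrix hy]
  have e1 : exponent p 1 = p 0 := rfl
  have e2 : exponent p 2 = p 1 := rfl
  have e3 : exponent p 3 = p 2 := rfl
  fin_cases j <;> simp [Fin.sum_univ_four, gamma, e1, e2, e3] <;> ring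

/-! ### Spacetimes that are locally Kasner -/

/-- In its charts, whose transition maps are locally translations, `S` is Kasner spacetime with
exponents `p`, and `τ` is the time coordinate. -/
structure IsLocallyKasner {M : Type*} [TopologicalSpace M] [ChartedSpace (Model 4) M]
    (S : Spacetime 4 M) (p : Fin 3 → ℝ) (τ : M → ℝ) : Prop where
  atlas : TranslationAtlas M
  coord_zero_symm : ∀ (q : M) (y : Model 4), y ∈ (extChartAt (𝓡 4) q).target →
    τ ((extChartAt (𝓡 4) q).symm y) = y 0
  pos : ∀ q, 0 < τ q
  metric_eq : ∀ (q : M) (v w : Model 4), S.metric q v w = kasnerForm p (τ q) v w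
  time_eq : ∀ q, S.time q = (stdVec 0 : Model 4)

theorem kasner_isLocallyKasner (p : Fin 3 → ℝ) :
    IsLocallyKasner (kasner p) p fun q => q.1 0 where
  atlas := kas_translationAtlas
  coord_zero_symm q y hy := by rw [(kas_target hy).2]
  pos q := q.2
  metric_eq _ _ _ := rfl
  time_eq _ := rfl

theorem cKasner_isLocallyKasner (p : Fin 3 → ℝ) (L : ℝ) :
    IsLocallyKasner (cKasner p L) p fun q => q.1 where
  atlas := ckas_translationAtlas L
  coord_zero_symm q y hy := by rw [(ckas_target hy).2]; rfl
  pos q := q.1.2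
  metric_eq _ _ _ := rfl
  time_eq _ := rfl

theorem TranslationAtlas.chartVector_eventuallyEq {M : Type*} [TopologicalSpace M]
    [ChartedSpace (Model 4) M] (h : TranslationAtlas M) (X : M → Model 4) {q : M}
    {y : Model 4} (hy : y ∈ (extChartAt (𝓡 4) q).target) :
    chartVector (fun q => (X q : TangentSpace (𝓡 4) q)) q =ᶠ[nhds y]
      fun z => X ((extChartAt (𝓡 4) q).symm z) := by
  filter_upwards [(isOpen_extChartAt_target q).mem_nhds hy] with z hz
  unfold chartVector
  rw [(h.hasMFDerivAt ((extChartAt (𝓡 4) q).map_target hz)).mfderiv]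
  rfl

namespace IsLocallyKasner

variable {M : Type*} [TopologicalSpace M] [ChartedSpace (Model 4) M] {S : Spacetime 4 M}
  {τ : M → ℝ}

theorem coord_zero (h : IsLocallyKasner S p τ) (q : M) : extChartAt (𝓡 4) q q 0 = τ q := by
  rw [← h.coord_zero_symm q _ (mem_extChartAt_target q), extChartAt_to_inv]

theorem pos_of_mem_target (h : IsLocallyKasner S p τ) {q : M} {y : Model 4}
    (hy : y ∈ (extChartAt (𝓡 4) q).target) : 0 < y 0 := by
  rw [← h.coord_zero_symm q y hy]
  exact h.pos _

theorem components_eventuallyEq (h : IsLocallyKasner S p τ) (q : M) :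
    S.components q =ᶠ[nhds (extChartAt (𝓡 4) q q)] metricMatrix p := by
  filter_upwards [(isOpen_extChartAt_target q).mem_nhds (mem_extChartAt_target q)] with z hz
  ext i j
  rw [Spacetime.components, h.atlas.chartComponents _ hz, h.metric_eq, h.coord_zero_symm q z hz,
    kasnerForm_stdVec, metricMatrix]

theorem isVacuum (h : IsLocallyKasner S p τ) (hsum : ∑ j, p j = 1) (hsq : ∑ j, p j ^ 2 = 1) :
    S.IsVacuum := fun q b d => by
  rw [ricci_congr (h.components_eventuallyEq q)]
  exact ricci_metricMatrix hsum hsq (h.pos_of_mem_target (mem_extChartAt_target q)) b d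

theorem christoffelVec_components (h : IsLocallyKasner S p τ) (q : M) (v w : Model 4) :
    christoffelVec (S.components q) (extChartAt (𝓡 4) q q) v w =
      christoffelVec (metricMatrix p) (extChartAt (𝓡 4) q q) v w :=
  christoffelVec_congr (h.components_eventuallyEq q) v w

theorem covDeriv_eq (h : IsLocallyKasner S p τ) (X : M → Model 4) (q : M) (v : Model 4) :
    S.covDeriv (fun q => (X q : TangentSpace (𝓡 4) q)) q v =
      (fderiv ℝ (fun z => X ((extChartAt (𝓡 4) q).symm z)) (extChartAt (𝓡 4) q q) v
        + christoffelVec (metricMatrix p) (extChartAt (𝓡 4) q q) v (X q) : Model 4) := by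
  have h1 := h.atlas.chartVector_eventuallyEq X (mem_extChartAt_target q)
  have h2 := h1.self_of_nhds
  beta_reduce at h2
  rw [extChartAt_to_inv] at h2
  rw [← h.christoffelVec_components, ← h1.fderiv_eq, ← h2]
  rfl

end IsLocallyKasner

end Kasner

/-! ### An obstruction to closed trapped submanifolds -/

namespace Kasner

open Lorentz Filter

variable {p : Fin 3 → ℝ}

/-- The Hessian `∂ₐ∂ᵦF - Γᶜₐᵦ ∂_c F` of a function in the coordinates of Kasner spacetime. -/
def hess (p : Fin 3 → ℝ) (F : Model 4 → ℝ) (y v w : Model 4) : ℝ :=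
  fderiv ℝ (fderiv ℝ F) y v w - fderiv ℝ F y (christoffelVec (metricMatrix p) y v w)

theorem pderiv_pderiv {k : ℕ} {ψ : Model k → Model 4} {u : Model k} (hψ : ContDiffAt ℝ 2 ψ u)
    (α β : Fin k) :
    pderiv α (pderiv β ψ) u = fderiv ℝ (fderiv ℝ ψ) u (stdVec α) (stdVec β) := by
  have hd : DifferentiableAt ℝ (fderiv ℝ ψ) u :=
    (hψ.fderiv_right (m := 1) (by norm_num)).differentiableAt (by simp)
  have := (hd.hasFDerivAt.clm_apply (hasFDerivAt_const (stdVec β : Model k) u)).fderiv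
  rw [pderiv, show pderiv β ψ = fun z => fderiv ℝ ψ z (stdVec β) from rfl, this]
  simp

/-- The vector `-h^{αβ} (a_αβ)^⊥` for the family `w` with Gram matrix `h`, where `⊥` is the component
orthogonal to `w`. -/
def normalTrace {k : ℕ} (B : Model 4 → Model 4 → ℝ) (w : Fin k → Model 4)
    (a : Fin k → Fin k → Model 4) : Model 4 :=
  -∑ α, ∑ β, (Matrix.of fun α β => B (w α) (w β))⁻¹ α β • (a α β - ∑ γ, ∑ δ,
    ((Matrix.of fun α β => B (w α) (w β))⁻¹ γ δ * B (a α β) (w γ)) • w δ)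

theorem normalTrace_congr {k : ℕ} {B B' : Model 4 → Model 4 → ℝ} {w w' : Fin k → Model 4}
    {a a' : Fin k → Fin k → Model 4} (hB : ∀ v v', B v v' = B' v v') (hw : ∀ α, w α = w' α)
    (ha : ∀ α β, a α β = a' α β) : normalTrace B w a = normalTrace B' w' a' := by
  obtain rfl : B = B' := funext fun v => funext fun v' => hB v v'
  obtain rfl : w = w' := funext hw
  obtain rfl : a = a' := funext fun α => funext fun β => ha α β
  rfl

/-- A covector that annihilates the tangent vectors does not see the tangential projection, so the
full accelerations may replace their normal parts. -/
theorem map_normalTrace {k : ℕ} (B : Model 4 → Model 4 → ℝ) {w : Fin k → Model 4}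
    (a : Fin k → Fin k → Model 4) (l : Model 4 →L[ℝ] ℝ) (hl : ∀ α, l (w α) = 0) :
    l (normalTrace B w a) =
      -∑ α, ∑ β, (Matrix.of fun α β => B (w α) (w β))⁻¹ α β * l (a α β) := by
  simp only [normalTrace, map_neg, map_sum, map_smul, map_sub, hl, smul_eq_mul,
    mul_zero, Finset.sum_const_zero, sub_zero]

section Submanifold

variable {M : Type*} [TopologicalSpace M] [ChartedSpace (Model 4) M] {S : Spacetime 4 M}
  {τ : M → ℝ} {k : ℕ} {P : Type*} [TopologicalSpace P] [ChartedSpace (Model k) P] {Φ : P → M}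
  {x : P}

/-- The accelerations `∇_{e_α} e_β` of a submanifold given by `ψ` in coordinates. -/
def coordAccel (p : Fin 3 → ℝ) (ψ : Model k → Model 4) (u : Model k) (α β : Fin k) : Model 4 :=
  fderiv ℝ (fderiv ℝ ψ) u (stdVec α) (stdVec β) + christoffelVec (metricMatrix p) (ψ u)
    (fderiv ℝ ψ u (stdVec α)) (fderiv ℝ ψ u (stdVec β))

theorem frame_eq (hΦ : ContMDiffAt (𝓡 k) (𝓡 4) ∞ Φ x) (α : Fin k) :
    Spacetime.frame Φ x α =
      fderiv ℝ (writtenInExtChartAt (𝓡 k) (𝓡 4) x Φ) (extChartAt (𝓡 k) x x) (stdVec α) := by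
  have := (hΦ.mdifferentiableAt (by simp)).mfderiv
  rw [ModelWithCorners.range_eq_univ, fderivWithin_univ] at this
  exact congrArg (fun l : Model k →L[ℝ] Model 4 => l (stdVec α)) this

theorem contDiffAt_written (hΦ : ContMDiffAt (𝓡 k) (𝓡 4) ∞ Φ x) :
    ContDiffAt ℝ 2 (writtenInExtChartAt (𝓡 k) (𝓡 4) x Φ) (extChartAt (𝓡 k) x x) := by
  have := (contMDiffAt_iff.mp hΦ).2
  rw [ModelWithCorners.range_eq_univ, contDiffWithinAt_univ] at this
  exact this.of_le (by norm_cast)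

theorem written_apply : writtenInExtChartAt (𝓡 k) (𝓡 4) x Φ (extChartAt (𝓡 k) x x) =
    extChartAt (𝓡 4) (Φ x) (Φ x) := by
  simp [writtenInExtChartAt]

theorem IsLocallyKasner.gram_eq (h : IsLocallyKasner S p τ)
    (hΦ : ContMDiffAt (𝓡 k) (𝓡 4) ∞ Φ x) {ψ : Model k → Model 4} {u : Model k}
    (hψ : ψ = writtenInExtChartAt (𝓡 k) (𝓡 4) x Φ) (hu : u = extChartAt (𝓡 k) x x) :
    S.gram (Φ x) (Spacetime.frame Φ x) = Matrix.of fun α β =>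
      kasnerForm p (τ (Φ x)) (fderiv ℝ ψ u (stdVec α)) (fderiv ℝ ψ u (stdVec β)) := by
  subst hψ hu
  ext α β
  simp only [← frame_eq hΦ]
  exact h.metric_eq _ _ _

theorem IsLocallyKasner.meanCurvature_eq (h : IsLocallyKasner S p τ)
    (hΦ : ContMDiffAt (𝓡 k) (𝓡 4) ∞ Φ x) {ψ : Model k → Model 4} {u : Model k}
    (hψ : ψ = writtenInExtChartAt (𝓡 k) (𝓡 4) x Φ) (hu : u = extChartAt (𝓡 k) x x) :
    S.meanCurvature (k := k) Φ x =
      normalTrace (fun v w => kasnerForm p (τ (Φ x)) v w)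
        (fun α => fderiv ℝ ψ u (stdVec α)) (coordAccel p ψ u) := by
  subst hψ hu
  have key : S.meanCurvature (k := k) Φ x = normalTrace (fun v w => S.metric (Φ x) v w)
      (fun α : Fin k => Spacetime.frame (m := 4) Φ x α) (fun α β : Fin k => S.frameAccel Φ x α β) := by
    unfold Spacetime.meanCurvature normalTrace Spacetime.normalPart Spacetime.gram
    rfl
  refine key.trans (normalTrace_congr (fun v w => h.metric_eq _ v w) (frame_eq hΦ) fun α β => ?_)
  rw [coordAccel, ← pderiv_pderiv (contDiffAt_written hΦ), written_apply,
    ← h.christoffelVec_components, ← frame_eq hΦ, ← frame_eq hΦ]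
  rfl

end Submanifold

/-- If `F` decreases along future timelike directions and the trace of its Hessian on the spacelike
`k`-planes in the kernel of its differential is nonnegative, then there is no `k`-dimensional closed
trapped submanifold: on such a submanifold, `F` would not have a maximum. -/
theorem IsLocallyKasner.not_isClosedTrapped {M : Type} [TopologicalSpace M]
    [ChartedSpace (Model 4) M] {S : Spacetime 4 M} {τ : M → ℝ} (h : IsLocallyKasner S p τ) {k : ℕ}
    {f : M → ℝ} {F : Model 4 → ℝ} (hF : ∀ y, 0 < y 0 → ContDiffAt ℝ 2 F y)
    (hfF : ∀ (q : M) (y : Model 4), y ∈ (extChartAt (𝓡 4) q).target →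
      f ((extChartAt (𝓡 4) q).symm y) = F y)
    (hfut : ∀ y v : Model 4, 0 < y 0 → kasnerForm p (y 0) v v < 0 →
      kasnerForm p (y 0) v (stdVec 0) < 0 → fderiv ℝ F y v < 0)
    (hconv : ∀ (y : Model 4) (w : Fin k → Model 4), 0 < y 0 → (∀ α, fderiv ℝ F y (w α) = 0) →
      (Matrix.of fun α β => kasnerForm p (y 0) (w α) (w β)).PosDef →
      0 ≤ ∑ α, ∑ β, (Matrix.of fun α β => kasnerForm p (y 0) (w α) (w β))⁻¹ α β *
        hess p F y (w α) (w β)) (C : Set M) :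
    ¬ S.IsClosedTrapped k C := by
  rintro ⟨P, _, _, Φ, hman, hcomp, hne, hemb, -, hpos, htrap⟩
  have hfc : Continuous f := by
    refine continuous_iff_continuousAt.mpr fun q => ?_
    have h1 : f =ᶠ[nhds q] fun z => F (extChartAt (𝓡 4) q z) := by
      filter_upwards [extChartAt_source_mem_nhds (I := 𝓡 4) q] with z hz
      rw [← hfF q _ ((extChartAt (𝓡 4) q).map_source hz), (extChartAt (𝓡 4) q).left_inv hz]
    refine ContinuousAt.congr ?_ h1.symm
    exact ContinuousAt.comp
      (hF _ (h.pos_of_mem_target (mem_extChartAt_target q))).continuousAt (continuousAt_extChartAt q)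
  obtain ⟨x, -, hx⟩ := isCompact_univ.exists_isMaxOn Set.univ_nonempty
    (hfc.comp hemb.contMDiff.continuous).continuousOn
  have hΦ : ContMDiffAt (𝓡 k) (𝓡 4) ∞ Φ x := hemb.contMDiff x
  obtain ⟨ψ, hψdef⟩ : ∃ ψ : Model k → Model 4, ψ = writtenInExtChartAt (𝓡 k) (𝓡 4) x Φ := ⟨_, rfl⟩
  obtain ⟨u, hu⟩ : ∃ u : Model k, u = extChartAt (𝓡 k) x x := ⟨_, rfl⟩
  have hψ : ContDiffAt ℝ 2 ψ u := by rw [hψdef, hu]; exact contDiffAt_written hΦ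
  have hψu : ψ u = extChartAt (𝓡 4) (Φ x) (Φ x) := by rw [hψdef, hu]; exact written_apply
  have hy0 : 0 < ψ u 0 := by rw [hψu]; exact h.pos_of_mem_target (mem_extChartAt_target _)
  have hτ : τ (Φ x) = ψ u 0 := by rw [hψu]; exact (h.coord_zero _).symm
  have hFy : ContDiffAt ℝ 2 F (ψ u) := hF _ hy0
  have hmax : IsLocalMax (F ∘ ψ) u := by
    have hc : ContinuousAt (fun z => Φ ((extChartAt (𝓡 k) x).symm z)) u :=
      ContinuousAt.comp hemb.contMDiff.continuous.continuousAt
        (hu ▸ continuousAt_extChartAt_symm x)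
    have hs : (extChartAt (𝓡 4) (Φ x)).source ∈ nhds (Φ ((extChartAt (𝓡 k) x).symm u)) := by
      rw [hu, extChartAt_to_inv]
      exact extChartAt_source_mem_nhds _
    have hval : ∀ z, Φ ((extChartAt (𝓡 k) x).symm z) ∈ (extChartAt (𝓡 4) (Φ x)).source →
        (F ∘ ψ) z = f (Φ ((extChartAt (𝓡 k) x).symm z)) := fun z hz => by
      rw [Function.comp_apply, hψdef]
      exact (hfF (Φ x) _ ((extChartAt (𝓡 4) (Φ x)).map_source hz)).symm.trans
        (congrArg f ((extChartAt (𝓡 4) (Φ x)).left_inv hz))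
    filter_upwards [hc.preimage_mem_nhds hs] with z hz
    rw [hval z hz, hval u (mem_of_mem_nhds hs), hu, extChartAt_to_inv]
    exact hx (Set.mem_univ _)
  -- First order condition at the maximum: the tangent space lies in `ker dF`.
  have hd1 : ∀ v, fderiv ℝ F (ψ u) (fderiv ℝ ψ u v) = 0 := fun v => by
    have h1 := hmax.fderiv_eq_zero
    rw [fderiv_comp u (hFy.differentiableAt (by simp)) (hψ.differentiableAt (by simp))] at h1
    exact congrArg (fun l => l v) h1
  have hApos := hpos x
  rw [h.gram_eq hΦ hψdef hu, hτ] at hApos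
  obtain ⟨ht1, ht2⟩ := htrap x
  rw [h.meanCurvature_eq hΦ hψdef hu] at ht1 ht2
  replace ht1 := (h.metric_eq _ _ _).symm.trans_lt ht1
  rw [h.time_eq] at ht2
  replace ht2 := (h.metric_eq _ _ _).symm.trans_lt ht2
  rw [hτ] at ht1 ht2
  -- Since `H` is future timelike, `dF(H) < 0`; on the tangent frame `dF` vanishes, so `dF(H)` is
  -- minus the trace of `dF(∇_{e_α} e_β)`.
  have hlt := hfut (ψ u) _ hy0 ht1 ht2
  rw [map_normalTrace _ _ _ fun α => hd1 _] at hlt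
  have hhess := hconv (ψ u) (fun α => fderiv ℝ ψ u (stdVec α)) hy0 (fun α => hd1 _) hApos
  set A := Matrix.of fun α β =>
    kasnerForm p (ψ u 0) (fderiv ℝ ψ u (stdVec α)) (fderiv ℝ ψ u (stdVec β))
  -- Second order condition: the trace of the Hessian of `F ∘ ψ` with respect to the induced metric
  -- is nonpositive.
  have hsecond : 0 ≤ ∑ α, ∑ β, A⁻¹ α β *
      -fderiv ℝ (fderiv ℝ (F ∘ ψ)) u (stdVec α) (stdVec β) := by
    refine hApos.inv.sum_mul_nonneg fun c => ?_
    have h1 := hmax.fderiv_fderiv_nonpos (hFy.comp u hψ) (∑ α, c α • stdVec α)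
    simp only [map_sum, map_smul, sum_apply, smul_apply, smul_eq_mul, Finset.mul_sum] at h1
    rw [Finset.sum_comm] at h1
    simp only [mul_neg, Finset.sum_neg_distrib]
    refine neg_nonneg.mpr (le_trans (le_of_eq ?_) h1)
    refine Finset.sum_congr rfl fun α _ => Finset.sum_congr rfl fun β _ => by ring
  -- By the chain rule, the two nonnegative traces add up to `dF(H)`: the Christoffel terms in
  -- `hess` and in `coordAccel` cancel.
  refine hlt.not_ge ((add_nonneg hsecond hhess).trans_eq ?_)
  rw [← Finset.sum_add_distrib, ← Finset.sum_neg_distrib]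
  refine Finset.sum_congr rfl fun α _ => ?_
  rw [← Finset.sum_add_distrib, ← Finset.sum_neg_distrib]
  refine Finset.sum_congr rfl fun β _ => ?_
  rw [fderiv_fderiv_comp hFy hψ, coordAccel, hess, map_add]
  ring

end Kasner

namespace Kasner

open Lorentz Filter

variable {p : Fin 3 → ℝ}

/-! ### The trace of the second fundamental form of the constant time slices -/

/-- The form `∑ⱼ pⱼ t^{2pⱼ-1} vʲ wʲ`, the second fundamental form of the slice at time `t`. -/
def sliceForm (p : Fin 3 → ℝ) (t : ℝ) (v w : Model 4) : ℝ :=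
  ∑ j : Fin 3, p j * (t ^ (2 * p j) / t) * (v j.succ * w j.succ)

theorem kasnerForm_covDeriv_time {y : Model 4} (hy : 0 < y 0) (v w : Model 4) (hw : w 0 = 0) :
    kasnerForm p (y 0) (fderiv ℝ (fun _ : Model 4 => (stdVec 0 : Model 4)) y v
      + christoffelVec (metricMatrix p) y v (stdVec 0)) w = sliceForm p (y 0) v w := by
  rw [fderiv_const_apply, zero_apply, zero_add, kasnerForm_apply, hw, sliceForm]
  simp only [christoffelVec_succ hy, stdVec_apply, mul_zero, neg_zero, zero_add]
  refine Finset.sum_congr rfl fun j _ => ?_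
  simp [Fin.succ_ne_zero]
  ring

/-- In the orthonormal frame `t^{-pⱼ} ∂ⱼ`, whose coefficients are the entries of `U`, the form is
diagonal with entries `pⱼ/t`. Its trace over the span of `w` is therefore `∑ pⱼ qⱼ / t`, where `qⱼ`
is the `j`-th diagonal entry of the orthogonal projection onto the span: each `qⱼ ≤ 1`, and they sum
to `k`. -/
theorem sum_inv_mul_sliceForm_nonneg (hsum : ∑ j, p j = 1) (hord : p 0 ≤ p 1 ∧ p 1 ≤ p 2)
    (h2 : p 2 < 1) {t : ℝ} (ht : 0 < t) {k : ℕ} (hk : 2 ≤ k) {w : Fin k → Model 4}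
    (hw : ∀ α, w α 0 = 0)
    (hpos : (Matrix.of fun α β => kasnerForm p t (w α) (w β)).PosDef) :
    0 ≤ ∑ α, ∑ β, (Matrix.of fun α β => kasnerForm p t (w α) (w β))⁻¹ α β *
      sliceForm p t (w α) (w β) := by
  set U : Matrix (Fin k) (Fin 3) ℝ := Matrix.of fun α j => t ^ p j * w α j.succ with hU
  have hsq : ∀ j, t ^ (2 * p j) = t ^ p j * t ^ p j := fun j => by
    rw [two_mul, Real.rpow_add ht]
  have hA : (Matrix.of fun α β => kasnerForm p t (w α) (w β)) = U * U.transpose := by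
    ext α β
    simp only [Matrix.of_apply, kasnerForm_apply, hw, Matrix.mul_apply, Matrix.transpose_apply, hU,
      mul_zero, neg_zero, zero_add]
    refine Finset.sum_congr rfl fun j _ => ?_
    rw [hsq]
    ring
  rw [hA] at hpos ⊢
  obtain ⟨hq1, hqk⟩ := Matrix.PosDef.projection_diag U hpos
  set A := U * U.transpose
  set q : Fin 3 → ℝ := fun j => ∑ α, ∑ β, A⁻¹ α β * (U α j * U β j) with hq
  have key : ∑ α, ∑ β, A⁻¹ α β * sliceForm p t (w α) (w β) = (∑ j, p j * q j) / t := by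
    have h1 : ∑ j, p j * q j = ∑ α, ∑ β, ∑ j, p j * (A⁻¹ α β * (U α j * U β j)) := by
      simp only [hq, Finset.mul_sum]
      rw [Finset.sum_comm]
      exact Finset.sum_congr rfl fun α _ => Finset.sum_comm
    rw [h1, Finset.sum_div]
    refine Finset.sum_congr rfl fun α _ => ?_
    rw [Finset.sum_div]
    refine Finset.sum_congr rfl fun β _ => ?_
    rw [sliceForm, Finset.mul_sum, Finset.sum_div]
    refine Finset.sum_congr rfl fun j _ => ?_
    rw [hsq]
    simp only [hU, Matrix.of_apply]
    ring
  rw [key]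
  refine div_nonneg ?_ ht.le
  have h2k : (2 : ℝ) ≤ k := by exact_mod_cast hk
  change ∀ j, q j ≤ 1 at hq1
  change ∑ j, q j = k at hqk
  rw [Fin.sum_univ_three] at hqk hsum ⊢
  -- Adding `a0` and `a1` and using that the `qⱼ` sum to `k` and the exponents to `1` gives `∑ pⱼ qⱼ
  -- ≥ (1 - p 2) + (k - 2) * p 2`, and both terms are nonnegative.
  have a0 : (p 2 - p 0) * (1 - q 0) ≥ 0 := mul_nonneg (by linarith) (by linarith [hq1 0])
  have a1 : (p 2 - p 1) * (1 - q 1) ≥ 0 := mul_nonneg (by linarith) (by linarith [hq1 1])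
  have a2 : 0 < p 2 := by linarith
  nlinarith [mul_nonneg a2.le (sub_nonneg.mpr h2k)]

/-! ### Functions and vector fields given by coordinate expressions -/

section Coord

variable {M : Type*} [TopologicalSpace M] [ChartedSpace (Model 4) M] {S : Spacetime 4 M}
  {τ : M → ℝ} {f : M → ℝ} {F : Model 4 → ℝ}

theorem eventuallyEq_coord (hfF : ∀ (q : M) (y : Model 4), y ∈ (extChartAt (𝓡 4) q).target →
    f ((extChartAt (𝓡 4) q).symm y) = F y) (q : M) :
    f =ᶠ[nhds q] F ∘ extChartAt (𝓡 4) q := by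
  filter_upwards [extChartAt_source_mem_nhds (I := 𝓡 4) q] with z hz
  rw [Function.comp_apply, ← hfF q _ ((extChartAt (𝓡 4) q).map_source hz),
    (extChartAt (𝓡 4) q).left_inv hz]

namespace IsLocallyKasner

theorem coord_pos (h : IsLocallyKasner S p τ) (q : M) : 0 < extChartAt (𝓡 4) q q 0 :=
  h.pos_of_mem_target (mem_extChartAt_target q)

theorem contMDiff_coord (h : IsLocallyKasner S p τ)
    (hfF : ∀ (q : M) (y : Model 4), y ∈ (extChartAt (𝓡 4) q).target →
      f ((extChartAt (𝓡 4) q).symm y) = F y)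
    (hF : ∀ y, 0 < y 0 → ContDiffAt ℝ ∞ F y) : ContMDiff (𝓡 4) 𝓘(ℝ, ℝ) ∞ f := fun q => by
  have := S.isManifold
  exact ((hF _ (h.coord_pos q)).contMDiffAt.comp q contMDiffAt_extChartAt).congr_of_eventuallyEq
    (eventuallyEq_coord hfF q)

theorem hasMFDerivAt_coord (h : IsLocallyKasner S p τ)
    (hfF : ∀ (q : M) (y : Model 4), y ∈ (extChartAt (𝓡 4) q).target →
      f ((extChartAt (𝓡 4) q).symm y) = F y) {q : M} {l : Model 4 →L[ℝ] ℝ}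
    (hF : HasFDerivAt F l (extChartAt (𝓡 4) q q)) : HasMFDerivAt (𝓡 4) 𝓘(ℝ, ℝ) f q l := by
  have h1 := HasMFDerivAt.comp q hF.hasMFDerivAt (h.atlas.hasMFDerivAt (mem_extChartAt_source q))
  exact h1.congr_of_eventuallyEq (eventuallyEq_coord hfF q)

/-- The level sets of a function with coordinate expression `F` are hypersurfaces with normal field
`X` with coordinate expression `V`. -/
theorem isHypersurfaceWithNormal (h : IsLocallyKasner S p τ)
    (hfF : ∀ (q : M) (y : Model 4), y ∈ (extChartAt (𝓡 4) q).target →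
      f ((extChartAt (𝓡 4) q).symm y) = F y)
    (hF : ∀ y, 0 < y 0 → ContDiffAt ℝ ∞ F y) {X : M → Model 4} {V : Model 4 → Model 4}
    (hXV : ∀ (q : M) (y : Model 4), y ∈ (extChartAt (𝓡 4) q).target →
      X ((extChartAt (𝓡 4) q).symm y) = V y)
    (hV : ∀ y, 0 < y 0 → ContDiffAt ℝ ∞ V y)
    (hnormal : ∀ y v, 0 < y 0 → kasnerForm p (y 0) (V y) v = fderiv ℝ F y v ∨
      kasnerForm p (y 0) (V y) v = -fderiv ℝ F y v)
    (hcausal : ∀ y, 0 < y 0 → kasnerForm p (y 0) (V y) (V y) ≤ 0)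
    (hfut : ∀ y, 0 < y 0 → kasnerForm p (y 0) (V y) (stdVec 0) < 0) (c : ℝ) :
    S.IsHypersurfaceWithNormal {q | f q = c} Set.univ (fun q => f q - c)
      (fun q => (X q : TangentSpace (𝓡 4) q)) := by
  have hfF' : ∀ (q : M) (y : Model 4), y ∈ (extChartAt (𝓡 4) q).target →
      (fun q => f q - c) ((extChartAt (𝓡 4) q).symm y) = (fun y => F y - c) y :=
    fun q y hy => by simp only [hfF q y hy]
  have hXq : ∀ q : M, X q = V (extChartAt (𝓡 4) q q) := fun q => by
    rw [← hXV q _ (mem_extChartAt_target q), extChartAt_to_inv]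
  refine ⟨isOpen_univ, ?_, fun q y hy => ?_, fun q _ => sub_eq_zero.symm, fun q _ => ?_⟩
  · exact (h.contMDiff_coord hfF' fun y hy => (hF y hy).sub contDiffAt_const).contMDiffOn
  · refine ((hV y (h.pos_of_mem_target hy.1)).congr_of_eventuallyEq ?_).contDiffWithinAt
    filter_upwards [h.atlas.chartVector_eventuallyEq X hy.1,
      (isOpen_extChartAt_target q).mem_nhds hy.1] with z hz hz'
    rw [hz, hXV q z hz']
  have hq := h.coord_pos q
  have hd := h.hasMFDerivAt_coord (f := fun q => f q - c) (F := fun y => F y - c) hfF'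
    (((hF _ hq).differentiableAt (by simp)).hasFDerivAt.sub_const c)
  have hmet : ∀ v : Model 4, S.metric q (X q) v =
      kasnerForm p (extChartAt (𝓡 4) q q 0) (V (extChartAt (𝓡 4) q q)) v := fun v => by
    rw [hXq q, h.coord_zero]
    exact h.metric_eq q _ v
  have hfq := hfut _ hq
  refine ⟨fun h0 => ?_, ⟨fun h0 => ?_, ?_, ?_⟩, fun v hv => ?_⟩
  · rw [hd.mfderiv] at h0
    replace h0 : fderiv ℝ F (extChartAt (𝓡 4) q q) (stdVec 0) = 0 :=
      congrArg (fun l : Model 4 →L[ℝ] ℝ => l (stdVec 0)) h0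
    rcases hnormal _ (stdVec 0) hq with h1 | h1 <;> rw [h1, h0] at hfq <;> simp at hfq
  · have h1 : V (extChartAt (𝓡 4) q q) = 0 := (hXq q).symm.trans h0
    rw [h1] at hfq
    simp at hfq
  · refine (hmet (X q)).trans_le ?_
    rw [hXq q]
    exact hcausal _ hq
  · rw [h.time_eq]
    exact (hmet _).trans_lt hfq
  · rw [hd.mfderiv] at hv
    replace hv : fderiv ℝ F (extChartAt (𝓡 4) q q) v = 0 := hv
    refine (hmet v).trans ?_
    rcases hnormal _ v hq with h1 | h1 <;> rw [h1, hv]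
    exact neg_zero

theorem metric_covDeriv (h : IsLocallyKasner S p τ) {X : M → Model 4} {V : Model 4 → Model 4}
    (hXV : ∀ (q : M) (y : Model 4), y ∈ (extChartAt (𝓡 4) q).target →
      X ((extChartAt (𝓡 4) q).symm y) = V y) (q : M) (v w : Model 4) :
    S.metric q (S.covDeriv (fun q => (X q : TangentSpace (𝓡 4) q)) q v) w =
      kasnerForm p (extChartAt (𝓡 4) q q 0) (fderiv ℝ V (extChartAt (𝓡 4) q q) v
        + christoffelVec (metricMatrix p) (extChartAt (𝓡 4) q q) v
          (V (extChartAt (𝓡 4) q q))) w := by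
  have h1 : (fun z => X ((extChartAt (𝓡 4) q).symm z)) =ᶠ[nhds (extChartAt (𝓡 4) q q)] V := by
    filter_upwards [(isOpen_extChartAt_target q).mem_nhds (mem_extChartAt_target q)] with z hz
    exact hXV q z hz
  have h2 : X q = V (extChartAt (𝓡 4) q q) := by
    rw [← hXV q _ (mem_extChartAt_target q), extChartAt_to_inv]
  rw [h.covDeriv_eq, h1.fderiv_eq, h2, h.coord_zero]
  exact h.metric_eq q _ w

/-! ### Convexity of the slices of constant time -/

theorem hasFDerivAt_time (y : Model 4) :
    HasFDerivAt (fun y : Model 4 => y 0) (EuclideanSpace.proj (𝕜 := ℝ) (0 : Fin 4)) y :=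
  (EuclideanSpace.proj (𝕜 := ℝ) (0 : Fin 4)).hasFDerivAt

theorem isKFutureConvex_slice (h : IsLocallyKasner S p τ) (hsum : ∑ j, p j = 1)
    (hord : p 0 ≤ p 1 ∧ p 1 ≤ p 2) (h2 : p 2 < 1) {k : ℕ} (hk : 2 ≤ k) (t : ℝ) :
    S.IsKFutureConvex k {q | τ q = t} := by
  intro q₀ _
  -- The future normal `∂_t` is minus the gradient of `t`, hence the second alternative for the sign
  -- below.
  have hn : ∀ y v : Model 4, kasnerForm p (y 0) (stdVec 0) v = -v 0 := fun y v => by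
    simp [kasnerForm_apply, stdVec_apply]
  refine ⟨Set.univ, fun q => τ q - t, fun q => (stdVec 0 : Model 4), Set.mem_univ _,
    h.isHypersurfaceWithNormal (F := fun y => y 0) (V := fun _ => stdVec 0) h.coord_zero_symm
      (fun y _ => (EuclideanSpace.proj (𝕜 := ℝ) (0 : Fin 4)).contDiff.contDiffAt)
      (fun _ _ _ => rfl) (fun _ _ => contDiffAt_const) (fun y v _ => Or.inr ?_) (fun y _ => ?_)
      (fun y _ => ?_) t, fun q _ w hw hpos => ?_⟩
  · rw [hn, (hasFDerivAt_time y).fderiv]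
    rfl
  · simp [hn, stdVec_apply]
  · simp [hn, stdVec_apply]
  have hd : HasMFDerivAt (𝓡 4) 𝓘(ℝ, ℝ) (fun q => τ q - t) q
      (EuclideanSpace.proj (𝕜 := ℝ) (0 : Fin 4)) :=
    h.hasMFDerivAt_coord (F := fun y => y 0 - t)
      (fun q y hy => by rw [h.coord_zero_symm q y hy]) ((hasFDerivAt_time _).sub_const t)
  rw [hd.mfderiv] at hw
  have hgram : S.gram q w = Matrix.of fun α β =>
      kasnerForm p (τ q) (w α : Model 4) (w β : Model 4) := by
    ext α β
    exact h.metric_eq q _ _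
  rw [hgram] at hpos ⊢
  refine (sum_inv_mul_sliceForm_nonneg hsum hord h2 (h.pos q) hk (w := w) hw hpos).trans_eq ?_
  refine Finset.sum_congr rfl fun α _ => Finset.sum_congr rfl fun β _ => congrArg _ ?_
  refine Eq.trans ?_
    (h.metric_covDeriv (X := fun _ => stdVec 0) (V := fun _ => stdVec 0) (fun _ _ _ => rfl) q
      (w α) (w β)).symm
  rw [← h.coord_zero q]
  exact (kasnerForm_covDeriv_time (h.coord_pos q) (w α) (w β) (hw β)).symm

end IsLocallyKasner

end Coord

end Kasner

namespace Kasner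

open Lorentz Filter

variable {p : Fin 3 → ℝ}

/-! ### Failure of `1`-future convexity -/

namespace IsLocallyKasner

variable {M : Type*} [TopologicalSpace M] [ChartedSpace (Model 4) M] {S : Spacetime 4 M}
  {τ : M → ℝ}

/-- Points of a constant time slice near `q` are reached along straight lines in the chart. -/
theorem eventually_line (h : IsLocallyKasner S p τ) {q : M} {U : Set M} (hU : IsOpen U)
    (hq : q ∈ U) {v : Model 4} (hv : v 0 = 0) :
    ∀ᶠ s : ℝ in nhds 0, (extChartAt (𝓡 4) q).symm (extChartAt (𝓡 4) q q + s • v) ∈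
      {z | τ z = τ q} ∩ U := by
  have hc : ContinuousAt (fun s : ℝ => extChartAt (𝓡 4) q q + s • v) 0 := by fun_prop
  have h0 : extChartAt (𝓡 4) q q + (0 : ℝ) • v = extChartAt (𝓡 4) q q := by simp
  have h1 : ∀ᶠ z in nhds (extChartAt (𝓡 4) q q),
      z ∈ (extChartAt (𝓡 4) q).target ∧ (extChartAt (𝓡 4) q).symm z ∈ U :=
    ((isOpen_extChartAt_target q).eventually_mem (mem_extChartAt_target q)).and
      ((continuousAt_extChartAt_symm q).eventually
        (by rw [extChartAt_to_inv]; exact hU.eventually_mem hq))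
  rw [← h0] at h1
  filter_upwards [hc.eventually h1] with s hs
  refine ⟨?_, hs.2⟩
  rw [Set.mem_ofPred_eq, h.coord_zero_symm q _ hs.1, ← h.coord_zero q]
  simp [hv]

/-- To refute convexity, every defining function and every normal field must be considered. What is
known about them holds only on the slice; differentiating along chart lines that stay in the slice
suffices for tangential derivatives. -/
theorem fderiv_eq_zero_of_eventually_line {E : Type*} [NormedAddCommGroup E] [NormedSpace ℝ E]
    {g : Model 4 → E} {y v : Model 4} (hg : DifferentiableAt ℝ g y) (l : E →L[ℝ] ℝ)
    (h : ∀ᶠ s : ℝ in nhds 0, l (g (y + s • v)) = 0) : l (fderiv ℝ g y v) = 0 := by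
  have hγ : HasDerivAt (fun s : ℝ => y + s • v) v 0 := by
    simpa only [one_smul, id] using ((hasDerivAt_id (0 : ℝ)).smul_const v).const_add y
  have h0 : y + (0 : ℝ) • v = y := by simp
  have h1 : HasFDerivAt g (fderiv ℝ g y) (y + (0 : ℝ) • v) := by rw [h0]; exact hg.hasFDerivAt
  have h2 := l.hasFDerivAt.comp_hasDerivAt (0 : ℝ) (h1.comp_hasDerivAt (0 : ℝ) hγ)
  have h3 : HasDerivAt (fun s : ℝ => l (g (y + s • v))) 0 0 :=
    (hasDerivAt_const (0 : ℝ) (0 : ℝ)).congr_of_eventuallyEq h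
  exact h2.unique h3

/-- A future causal normal field of a constant time slice is future directed along `∂_t`. -/
theorem normal_slice (h : IsLocallyKasner S p τ) {t : ℝ} {U : Set M} {f : M → ℝ} {N : M → Model 4}
    (hN : S.IsHypersurfaceWithNormal {q | τ q = t} U f (fun q => (N q : TangentSpace (𝓡 4) q)))
    {q : M} (hq : q ∈ {q | τ q = t} ∩ U) :
    (∀ v : Model 4, v 0 = 0 → mfderiv (𝓡 4) 𝓘(ℝ, ℝ) f q v = 0) ∧
      (∀ j : Fin 3, N q j.succ = 0) ∧ 0 < N q 0 := by
  obtain ⟨hU, hf, -, hiff, hn⟩ := hN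
  obtain ⟨-, ⟨-, -, hfut⟩, hperp⟩ := hn q hq
  have hfd : MDifferentiableAt (𝓡 4) 𝓘(ℝ, ℝ) f q :=
    (hf.contMDiffAt (hU.mem_nhds hq.2)).mdifferentiableAt (by simp)
  have hker : ∀ v : Model 4, v 0 = 0 → mfderiv (𝓡 4) 𝓘(ℝ, ℝ) f q v = 0 := fun v hv => by
    have h1 := hfd.mfderiv
    have h2 := hfd.differentiableWithinAt_writtenInExtChartAt
    rw [ModelWithCorners.range_eq_univ] at h1 h2
    rw [fderivWithin_univ] at h1
    rw [differentiableWithinAt_univ] at h2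
    rw [h1]
    refine fderiv_eq_zero_of_eventually_line h2 (ContinuousLinearMap.id ℝ ℝ) ?_
    filter_upwards [h.eventually_line hU hq.2 hv] with s hs
    refine (hiff _ hs.2).mp ?_
    exact hs.1.trans hq.1
  have hperp' : ∀ v : Model 4, v 0 = 0 → kasnerForm p (τ q) (N q) v = 0 := fun v hv =>
    (h.metric_eq q _ v).symm.trans (hperp v (hker v hv))
  refine ⟨hker, fun j => ?_, ?_⟩
  · have := hperp' (stdVec j.succ) (by simp [stdVec_apply, (Fin.succ_ne_zero j).symm])
    rw [kasnerForm_apply] at this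
    simpa [stdVec_apply, (Fin.succ_ne_zero j).symm, (Real.rpow_pos_of_pos (h.pos q) _).ne']
      using this
  · rw [h.time_eq] at hfut
    have := (h.metric_eq q _ _).symm.trans_lt hfut
    simpa [kasnerForm_apply, stdVec_apply] using this

/-- Along the slice every admissible normal is `N = λ ∂_t` with `λ > 0`, so `⟨∇_{∂₁} N, ∂₁⟩ = λ
(p₁/t) t^{2p₁} < 0`, whatever the choice of `N`. -/
theorem not_isKFutureConvex_one_slice (h : IsLocallyKasner S p τ) (h0 : p 0 < 0) {t : ℝ} {q : M}
    (hq : τ q = t) : ¬ S.IsKFutureConvex 1 {q | τ q = t} := by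
  intro hconv
  obtain ⟨U, f, N, hqU, hN, hconv⟩ := hconv q hq
  have hqH : q ∈ {q | τ q = t} ∩ U := ⟨hq, hqU⟩
  obtain ⟨hker, hNj, hN0⟩ := h.normal_slice (N := N) hN hqH
  have hv1 : (stdVec 1 : Model 4) 0 = 0 := by simp [stdVec_apply]
  have hform : ∀ v : Model 4, kasnerForm p (τ q) v (stdVec 1) = τ q ^ (2 * p 0) * v 1 := fun v => by
    simp [kasnerForm_apply, stdVec_apply, Fin.sum_univ_three]
  have hpow := Real.rpow_pos_of_pos (h.pos q) (2 * p 0)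
  have hgram : S.gram q (fun _ : Fin 1 => (stdVec 1 : Model 4)) =
      Matrix.of fun _ _ => τ q ^ (2 * p 0) := by
    ext α β
    exact (h.metric_eq q _ _).trans (by rw [hform]; simp [stdVec_apply])
  have hpos : (S.gram q (fun _ : Fin 1 => (stdVec 1 : Model 4))).PosDef := by
    have : S.gram q (fun _ : Fin 1 => (stdVec 1 : Model 4)) =
        Matrix.diagonal fun _ => τ q ^ (2 * p 0) := by
      rw [hgram]
      ext α β
      rw [Subsingleton.elim α β, Matrix.diagonal_apply_eq, Matrix.of_apply]
    rw [this]
    exact Matrix.PosDef.diagonal fun _ => hpow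
  have key := hconv q hqH (fun _ => (stdVec 1 : Model 4)) (fun _ => hker _ hv1) hpos
  rw [Fin.sum_univ_one, Fin.sum_univ_one] at key
  have hinv := hpos.inv.diag_pos (i := 0)
  refine key.not_gt (mul_neg_of_pos_of_neg hinv ?_)
  have hcov := h.covDeriv_eq N q (stdVec 1)
  refine (h.metric_eq q (S.covDeriv N q (stdVec 1 : Model 4)) (stdVec 1)).trans_lt ?_
  rw [hcov, hform]
  refine mul_neg_of_pos_of_neg hpow ?_
  have hy := h.coord_pos q
  have hev := h.atlas.chartVector_eventuallyEq N (mem_extChartAt_target q)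
  have hdiff : DifferentiableAt ℝ (fun z => (N ((extChartAt (𝓡 4) q).symm z) : Model 4))
      (extChartAt (𝓡 4) q q) := by
    refine DifferentiableAt.congr_of_eventuallyEq ?_ hev.symm
    refine ((hN.2.2.1 q).contDiffAt ?_).differentiableAt (by simp)
    refine Filter.inter_mem ((isOpen_extChartAt_target q).mem_nhds (mem_extChartAt_target q)) ?_
    refine (continuousAt_extChartAt_symm q).preimage_mem_nhds ?_
    rw [extChartAt_to_inv]
    exact hN.1.mem_nhds hqU
  -- The first spatial component of `N` vanishes along the slice, so its derivative in the tangent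
  -- direction `∂₁` does too, and only the Christoffel term is left.
  have hzero := fderiv_eq_zero_of_eventually_line (v := stdVec 1) hdiff
    (EuclideanSpace.proj (𝕜 := ℝ) (1 : Fin 4)) (by
      filter_upwards [h.eventually_line hN.1 hqU hv1] with s hs
      exact (h.normal_slice (N := N) hN ⟨hs.1.trans hq, hs.2⟩).2.1 0)
  have hzero' : (fderiv ℝ (fun z => (N ((extChartAt (𝓡 4) q).symm z) : Model 4))
      (extChartAt (𝓡 4) q q) (stdVec 1)) 1 = 0 := hzero
  have hΓ := christoffelVec_succ (p := p) hy (stdVec 1) (N q) 0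
  rw [PiLp.add_apply, hzero', zero_add]
  refine hΓ.trans_lt ?_
  rw [hNj 0]
  simp only [stdVec_apply]
  simpa using mul_neg_of_neg_of_pos (div_neg_of_neg_of_pos h0 hy) hN0

end IsLocallyKasner

/-! ### Closed trapped surfaces -/

theorem fderiv_neg_time (y : Model 4) : fderiv ℝ (fun y : Model 4 => -y 0) y =
    -EuclideanSpace.proj (𝕜 := ℝ) (0 : Fin 4) :=
  (IsLocallyKasner.hasFDerivAt_time y).neg.fderiv

/-- The maximum principle applied to `-t`, whose Hessian `Γ⁰(v, w)` is the second fundamental form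
of the slices; the trace bound is the case `k = 2`. -/
theorem IsLocallyKasner.not_isClosedTrapped_surface {M : Type} [TopologicalSpace M]
    [ChartedSpace (Model 4) M] {S : Spacetime 4 M} {τ : M → ℝ} (h : IsLocallyKasner S p τ)
    (hsum : ∑ j, p j = 1) (hord : p 0 ≤ p 1 ∧ p 1 ≤ p 2) (h2 : p 2 < 1) (C : Set M) :
    ¬ S.IsClosedTrapped 2 C := by
  refine h.not_isClosedTrapped (f := fun q => -τ q) (F := fun y => -y 0)
    (fun y _ => (EuclideanSpace.proj (𝕜 := ℝ) (0 : Fin 4)).contDiff.neg.contDiffAt)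
    (fun q y hy => by rw [h.coord_zero_symm q y hy]) (fun y v _ _ hv => ?_)
    (fun y w hy hw hpos => ?_) C
  · rw [fderiv_neg_time]
    simpa [kasnerForm_apply, stdVec_apply] using hv
  · have hw0 : ∀ α, w α 0 = 0 := fun α => by
      have := hw α
      rw [fderiv_neg_time] at this
      simpa using this
    refine (sum_inv_mul_sliceForm_nonneg hsum hord h2 hy le_rfl hw0 hpos).trans_eq ?_
    refine Finset.sum_congr rfl fun α _ => Finset.sum_congr rfl fun β _ => congrArg _ ?_
    have : fderiv ℝ (fun y : Model 4 => -y 0) =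
        fun _ => -EuclideanSpace.proj (𝕜 := ℝ) (0 : Fin 4) := funext fderiv_neg_time
    rw [hess, this, sliceForm, ← christoffelVec_zero hy]
    simp

end Kasner

namespace Kasner

open Lorentz Filter

variable {p : Fin 3 → ℝ}

/-! ### The eikonal function -/

/-- The coordinate expression of `eikonal p`. -/
def eikonalCoord (p : Fin 3 → ℝ) (y : Model 4) : ℝ := y 1 - y 0 ^ (1 - p 0) / (1 - p 0)

/-- The coordinate expression of the gradient of `eikonal p`. -/
def eikonalGrad (p : Fin 3 → ℝ) (y : Model 4) : Model 4 :=
  y 0 ^ (-p 0) • stdVec 0 + y 0 ^ (-(2 * p 0)) • stdVec 1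

theorem eikonal_coord (q : Kas) (y : Model 4) (hy : y ∈ (extChartAt (𝓡 4) q).target) :
    eikonal p ((extChartAt (𝓡 4) q).symm y) = eikonalCoord p y := by
  rw [(kas_target hy).2]
  rfl

theorem contDiffAt_rpow_time (c : ℝ) {y : Model 4} (hy : 0 < y 0) :
    ContDiffAt ℝ ∞ (fun y : Model 4 => y 0 ^ c) y :=
  ContDiffAt.rpow_const_of_ne (EuclideanSpace.proj (𝕜 := ℝ) (0 : Fin 4)).contDiff.contDiffAt hy.ne'

theorem contDiffAt_eikonalCoord {y : Model 4} (hy : 0 < y 0) :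
    ContDiffAt ℝ ∞ (eikonalCoord p) y :=
  (EuclideanSpace.proj (𝕜 := ℝ) (1 : Fin 4)).contDiff.contDiffAt.sub
    ((contDiffAt_rpow_time _ hy).div_const _)

theorem contDiffAt_eikonalGrad {y : Model 4} (hy : 0 < y 0) :
    ContDiffAt ℝ ∞ (eikonalGrad p) y :=
  ((contDiffAt_rpow_time _ hy).smul contDiffAt_const).add
    ((contDiffAt_rpow_time _ hy).smul contDiffAt_const)

theorem hasFDerivAt_rpow_time (c : ℝ) {y : Model 4} (hy : 0 < y 0) :
    HasFDerivAt (fun y : Model 4 => y 0 ^ c)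
      ((c * y 0 ^ (c - 1)) • EuclideanSpace.proj (𝕜 := ℝ) (0 : Fin 4)) y :=
  HasDerivAt.comp_hasFDerivAt (h₂ := fun t : ℝ => t ^ c) y
    (Real.hasDerivAt_rpow_const (Or.inl hy.ne')) (IsLocallyKasner.hasFDerivAt_time y)

theorem fderiv_eikonalCoord (hp : p 0 < 0) {y : Model 4} (hy : 0 < y 0) :
    fderiv ℝ (eikonalCoord p) y = EuclideanSpace.proj (𝕜 := ℝ) (1 : Fin 4)
      - y 0 ^ (-p 0) • EuclideanSpace.proj (𝕜 := ℝ) (0 : Fin 4) := by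
  have h1 := ((EuclideanSpace.proj (𝕜 := ℝ) (1 : Fin 4)).hasFDerivAt (x := y)).sub
    ((hasFDerivAt_rpow_time (1 - p 0) hy).mul_const (1 - p 0)⁻¹)
  refine (h1.congr_fderiv ?_).fderiv
  have h2 : (1 - p 0) ≠ 0 := by linarith
  rw [smul_smul, ← mul_assoc, inv_mul_cancel₀ h2, one_mul, sub_sub_cancel_left]

theorem fderiv_eikonalCoord_apply (hp : p 0 < 0) {y : Model 4} (hy : 0 < y 0) (v : Model 4) :
    fderiv ℝ (eikonalCoord p) y v = v 1 - y 0 ^ (-p 0) * v 0 := by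
  rw [fderiv_eikonalCoord hp hy]
  simp

theorem fderiv_fderiv_eikonalCoord (hp : p 0 < 0) {y : Model 4} (hy : 0 < y 0) (v w : Model 4) :
    fderiv ℝ (fderiv ℝ (eikonalCoord p)) y v w = p 0 * (y 0 ^ (-p 0) / y 0) * (v 0 * w 0) := by
  have hev : fderiv ℝ (eikonalCoord p) =ᶠ[nhds y] fun y : Model 4 =>
      EuclideanSpace.proj (𝕜 := ℝ) (1 : Fin 4)
        - y 0 ^ (-p 0) • EuclideanSpace.proj (𝕜 := ℝ) (0 : Fin 4) := by
    filter_upwards [halfSpace.2.mem_nhds hy] with z hz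
    exact fderiv_eikonalCoord hp hz
  have h1 := ((hasFDerivAt_rpow_time (-p 0) hy).smul_const
    (EuclideanSpace.proj (𝕜 := ℝ) (0 : Fin 4))).const_sub (EuclideanSpace.proj (𝕜 := ℝ) (1 : Fin 4))
  rw [hev.fderiv_eq, h1.fderiv, Real.rpow_sub_one hy.ne']
  simp
  ring

theorem fderiv_eikonalGrad {y : Model 4} (hy : 0 < y 0) (v : Model 4) :
    fderiv ℝ (eikonalGrad p) y v = (-p 0 * (y 0 ^ (-p 0) / y 0) * v 0) • stdVec 0
      + (-(2 * p 0) * (y 0 ^ (-(2 * p 0)) / y 0) * v 0) • stdVec 1 := by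
  have h1 := ((hasFDerivAt_rpow_time (-p 0) hy).smul_const (stdVec 0 : Model 4)).add
    ((hasFDerivAt_rpow_time (-(2 * p 0)) hy).smul_const (stdVec 1 : Model 4))
  rw [show fderiv ℝ (eikonalGrad p) y = _ from h1.fderiv, Real.rpow_sub_one hy.ne',
    Real.rpow_sub_one hy.ne']
  simp

theorem eikonalGrad_zero (y : Model 4) : eikonalGrad p y 0 = y 0 ^ (-p 0) := by
  simp [eikonalGrad, stdVec_apply]

theorem eikonalGrad_one (y : Model 4) : eikonalGrad p y 1 = y 0 ^ (-(2 * p 0)) := by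
  simp [eikonalGrad, stdVec_apply]

theorem eikonalGrad_succ_succ (y : Model 4) (j : Fin 2) : eikonalGrad p y j.succ.succ = 0 := by
  have : j.succ.succ ≠ (1 : Fin 4) := fun h => Fin.succ_ne_zero j (Fin.succ_injective _ h)
  simp [eikonalGrad, stdVec_apply, this, Fin.succ_ne_zero]

theorem rpow_two_mul_time {t : ℝ} (ht : 0 < t) (c : ℝ) : t ^ (2 * c) = (t ^ c) ^ 2 := by
  rw [mul_comm, Real.rpow_mul ht.le]
  norm_cast

theorem kasnerForm_eikonalGrad (hp : p 0 < 0) {y : Model 4} (hy : 0 < y 0) (v : Model 4) :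
    kasnerForm p (y 0) (eikonalGrad p y) v = fderiv ℝ (eikonalCoord p) y v := by
  have hT := Real.rpow_pos_of_pos hy (p 0)
  rw [kasnerForm_apply, fderiv_eikonalCoord_apply hp hy, Fin.sum_univ_succ, Fin.sum_univ_two]
  have h1 := eikonalGrad_succ_succ (p := p) y 0
  have h2 := eikonalGrad_succ_succ (p := p) y 1
  rw [h1, h2, Fin.succ_zero_eq_one, eikonalGrad_zero, eikonalGrad_one, Real.rpow_neg hy.le (2 * p 0)]
  rw [rpow_two_mul_time hy (p 0)]
  field_simp
  ring

/-- The exponent `1 - p₁` is chosen so that the `t`-derivative is `-t^{-p₁}`; the squared lengths of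
the time part and the `x¹` part of the gradient are then `-t^{-2p₁}` and `t^{-2p₁}`. -/
theorem eikonalGrad_null (hp : p 0 < 0) {y : Model 4} (hy : 0 < y 0) :
    kasnerForm p (y 0) (eikonalGrad p y) (eikonalGrad p y) = 0 := by
  rw [kasnerForm_eikonalGrad hp hy, fderiv_eikonalCoord_apply hp hy, eikonalGrad_zero,
    eikonalGrad_one, ← Real.rpow_add hy, sub_eq_zero]
  congr 1
  ring

theorem eikonalGrad_future (y : Model 4) (hy : 0 < y 0) :
    kasnerForm p (y 0) (eikonalGrad p y) (stdVec 0) < 0 := by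
  rw [kasnerForm_comm]
  simpa [kasnerForm_apply, stdVec_apply, eikonalGrad_zero] using Real.rpow_pos_of_pos hy (-p 0)

/-- On the kernel of the differential of `eikonal p`, the Hessian is a sum of nonnegative terms. -/
theorem hess_eikonalCoord (hp : p 0 < 0) {y : Model 4} (hy : 0 < y 0) {v w : Model 4}
    (hv : fderiv ℝ (eikonalCoord p) y v = 0) (hw : fderiv ℝ (eikonalCoord p) y w = 0) :
    hess p (eikonalCoord p) y v w = p 1 * (y 0 ^ (2 * p 1) / y 0 * y 0 ^ (-p 0)) * (v 2 * w 2)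
      + p 2 * (y 0 ^ (2 * p 2) / y 0 * y 0 ^ (-p 0)) * (v 3 * w 3) := by
  have hT := Real.rpow_pos_of_pos hy (p 0)
  rw [fderiv_eikonalCoord_apply hp hy, sub_eq_zero] at hv hw
  have h1 := christoffelVec_succ (p := p) hy v w 0
  rw [Fin.succ_zero_eq_one] at h1
  -- On the kernel `v¹ = t^{-p₁} v⁰`. In units of `p₁ t^{-p₁-1} v⁰ w⁰`, the second derivative
  -- contributes `1`, the `Γ¹` term `-2`, and the `x¹` part of the `Γ⁰` term `1`, so the direction
  -- with negative exponent drops out.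
  rw [hess, fderiv_fderiv_eikonalCoord hp hy, fderiv_eikonalCoord_apply hp hy,
    christoffelVec_zero hy, h1, Fin.sum_univ_three, Fin.succ_zero_eq_one, hv, hw]
  have s1 : Fin.succ (1 : Fin 3) = 2 := rfl
  have s2 : Fin.succ (2 : Fin 3) = 3 := rfl
  rw [s1, s2, Real.rpow_neg hy.le, rpow_two_mul_time hy (p 0)]
  field_simp
  ring

/-- The covariant derivative of the gradient of `eikonal p` is its Hessian. -/
theorem kasnerForm_covDeriv_eikonalGrad (hp : p 0 < 0) {y : Model 4} (hy : 0 < y 0)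
    (v w : Model 4) :
    kasnerForm p (y 0) (fderiv ℝ (eikonalGrad p) y v
      + christoffelVec (metricMatrix p) y v (eikonalGrad p y)) w =
      hess p (eikonalCoord p) y v w := by
  have hT := Real.rpow_pos_of_pos hy (p 0)
  have s0 : Fin.succ (0 : Fin 3) = 1 := rfl
  have s1 : Fin.succ (1 : Fin 3) = 2 := rfl
  have s2 : Fin.succ (2 : Fin 3) = 3 := rfl
  have g2 : eikonalGrad p y 2 = 0 := eikonalGrad_succ_succ y 0
  have g3 : eikonalGrad p y 3 = 0 := eikonalGrad_succ_succ y 1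
  have c1 : ∀ v w, christoffelVec (metricMatrix p) y v w 1 = _ := fun v w =>
    christoffelVec_succ (p := p) hy v w 0
  have c2 : ∀ v w, christoffelVec (metricMatrix p) y v w 2 = _ := fun v w =>
    christoffelVec_succ (p := p) hy v w 1
  have c3 : ∀ v w, christoffelVec (metricMatrix p) y v w 3 = _ := fun v w =>
    christoffelVec_succ (p := p) hy v w 2
  rw [hess, fderiv_fderiv_eikonalCoord hp hy, fderiv_eikonalCoord_apply hp hy, kasnerForm_apply,
    fderiv_eikonalGrad hy]
  simp only [PiLp.add_apply, PiLp.smul_apply, stdVec_apply, christoffelVec_zero hy, c1, c2, c3,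
    Fin.sum_univ_three, s0, s1, s2, g2, g3, eikonalGrad_zero, eikonalGrad_one]
  rw [Real.rpow_neg hy.le (2 * p 0), Real.rpow_neg hy.le, rpow_two_mul_time hy (p 0)]
  have n1 : ¬ (0 : Fin 4) = 1 := by decide
  have n2 : ¬ (2 : Fin 4) = 0 := by decide
  have n3 : ¬ (3 : Fin 4) = 0 := by decide
  have n4 : ¬ (2 : Fin 4) = 1 := by decide
  have n5 : ¬ (3 : Fin 4) = 1 := by decide
  have n6 : ¬ (1 : Fin 4) = 0 := by decide
  simp only [n1, n2, n3, n4, n5, n6, if_false, if_true, smul_eq_mul]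
  field_simp
  ring

/-! ### Level sets of the eikonal function -/

theorem contMDiff_eikonal (p : Fin 3 → ℝ) : ContMDiff (𝓡 4) 𝓘(ℝ, ℝ) ∞ (eikonal p) :=
  (kasner_isLocallyKasner p).contMDiff_coord eikonal_coord fun _ hy => contDiffAt_eikonalCoord hy

theorem mfderiv_eikonal (q : Kas) :
    mfderiv (𝓡 4) 𝓘(ℝ, ℝ) (eikonal p) q = fderiv ℝ (eikonalCoord p) q.1 :=
  ((kasner_isLocallyKasner p).hasMFDerivAt_coord eikonal_coord
    ((contDiffAt_eikonalCoord q.2).differentiableAt (by simp)).hasFDerivAt).mfderiv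

theorem exists_null_gradient (hp : p 0 < 0) (q : Kas) : ∃ v : TangentSpace (𝓡 4) q,
    (kasner p).IsGradient (eikonal p) q v ∧ (kasner p).IsFutureNull q v := by
  refine ⟨(eikonalGrad p q.1 : Model 4), fun w => ?_, fun h0 => ?_, eikonalGrad_null hp q.2,
    eikonalGrad_future q.1 q.2⟩
  · rw [mfderiv_eikonal]
    exact kasnerForm_eikonalGrad hp q.2 w
  · have h1 := eikonalGrad_future (p := p) q.1 q.2
    rw [show eikonalGrad p q.1 = 0 from h0] at h1
    simp at h1

theorem isFutureConvex_eikonal (hp : p 0 < 0) (hp1 : 0 < p 1) (hp2 : 0 < p 2) (c : ℝ) :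
    (kasner p).IsFutureConvex {q | eikonal p q = c} := by
  have hcoord : ∀ (q : Kas) (y : Model 4), y ∈ (extChartAt (𝓡 4) q).target →
      eikonalGrad p ((extChartAt (𝓡 4) q).symm y).1 = eikonalGrad p y := fun q y hy => by
    rw [(kas_target hy).2]
  intro q₀ _
  refine ⟨Set.univ, fun q => eikonal p q - c, fun q => (eikonalGrad p q.1 : Model 4),
    Set.mem_univ _, (kasner_isLocallyKasner p).isHypersurfaceWithNormal eikonal_coord
      (fun y hy => contDiffAt_eikonalCoord hy) hcoord (fun y hy => contDiffAt_eikonalGrad hy)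
      (fun y v hy => Or.inl (kasnerForm_eikonalGrad hp hy v))
      (fun y hy => (eikonalGrad_null hp hy).le) eikonalGrad_future c, fun q _ X hX _ => ?_⟩
  have hd := (kasner_isLocallyKasner p).hasMFDerivAt_coord (f := fun q => eikonal p q - c)
    (F := fun y => eikonalCoord p y - c) (q := q) (fun q y hy => by rw [eikonal_coord q y hy])
    (((contDiffAt_eikonalCoord (p := p) q.2).differentiableAt (by simp)).hasFDerivAt.sub_const c)
  rw [hd.mfderiv] at hX
  refine le_of_le_of_eq ?_ ((kasner_isLocallyKasner p).metric_covDeriv hcoord q X X).symm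
  refine le_of_le_of_eq ?_ (kasnerForm_covDeriv_eikonalGrad hp q.2 X X).symm
  refine le_of_le_of_eq ?_ (hess_eikonalCoord hp q.2 hX hX).symm
  have h0 : 0 < q.1 0 := q.2
  refine add_nonneg (mul_nonneg ?_ (mul_self_nonneg _)) (mul_nonneg ?_ (mul_self_nonneg _)) <;>
    positivity

/-- Kasner spacetime has no closed trapped submanifolds. -/
theorem kasner_not_isClosedTrapped (hp : p 0 < 0) (hp1 : 0 < p 1) (hp2 : 0 < p 2) (k : ℕ)
    (C : Set Kas) : ¬ (kasner p).IsClosedTrapped k C := by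
  refine (kasner_isLocallyKasner p).not_isClosedTrapped (F := eikonalCoord p)
    (fun y hy => (contDiffAt_eikonalCoord hy).of_le (by norm_cast)) eikonal_coord
    (fun y v hy hv1 hv2 => ?_) (fun y w hy hw hpos => ?_) C
  · have hT := Real.rpow_pos_of_pos hy (p 0)
    rw [fderiv_eikonalCoord_apply hp hy, Real.rpow_neg hy.le]
    have hv0 : 0 < v 0 := by simpa [kasnerForm_apply, stdVec_apply] using hv2
    rw [kasnerForm_apply, Fin.sum_univ_three, rpow_two_mul_time hy (p 0), Fin.succ_zero_eq_one] at hv1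
    have h1 : 0 ≤ y 0 ^ (2 * p 1) * (v (Fin.succ 1) * v (Fin.succ 1)) :=
      mul_nonneg (Real.rpow_pos_of_pos hy _).le (mul_self_nonneg _)
    have h2 : 0 ≤ y 0 ^ (2 * p 2) * (v (Fin.succ 2) * v (Fin.succ 2)) :=
      mul_nonneg (Real.rpow_pos_of_pos hy _).le (mul_self_nonneg _)
    -- A future timelike vector satisfies `t^{p₁} |v¹| < v⁰`, which is what makes `dF(v) = v¹ -
    -- t^{-p₁} v⁰` negative.
    have h3 : (y 0 ^ p 0 * v 1) ^ 2 < v 0 ^ 2 := by linarith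
    have h4 : y 0 ^ p 0 * v 1 < v 0 := lt_of_pow_lt_pow_left₀ 2 hv0.le h3
    rw [sub_neg, inv_mul_eq_div, lt_div_iff₀ hT]
    linarith
  · have hsq : ∀ i : Fin 4, 0 ≤ ∑ α, ∑ β,
        (Matrix.of fun α β => kasnerForm p (y 0) (w α) (w β))⁻¹ α β * (w α i * w β i) := fun i => by
      refine hpos.inv.sum_mul_nonneg fun c => ?_
      have : ∑ α, ∑ β, c α * c β * (w α i * w β i) = (∑ α, c α * w α i) * ∑ β, c β * w β i := by
        rw [Finset.sum_mul_sum]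
        exact Finset.sum_congr rfl fun α _ => Finset.sum_congr rfl fun β _ => by ring
      rw [this]
      exact mul_self_nonneg _
    have ha : 0 ≤ p 1 * (y 0 ^ (2 * p 1) / y 0 * y 0 ^ (-p 0)) := by positivity
    have hb : 0 ≤ p 2 * (y 0 ^ (2 * p 2) / y 0 * y 0 ^ (-p 0)) := by positivity
    refine (add_nonneg (mul_nonneg ha (hsq 2)) (mul_nonneg hb (hsq 3))).trans_eq ?_
    simp only [Finset.mul_sum, ← Finset.sum_add_distrib]
    refine Finset.sum_congr rfl fun α _ => Finset.sum_congr rfl fun β _ => ?_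
    rw [hess_eikonalCoord hp hy (hw α) (hw β)]
    ring

end Kasner

/-! ### Curves that are affine in charts are immersions -/

namespace Lorentz

open Filter

/-- The linear equivalence `(u, f) ↦ (f⁰, u, f¹, f²)`. -/
def splitEquiv : (Model 1 × Model 3) ≃L[ℝ] Model 4 :=
  LinearEquiv.toContinuousLinearEquiv
    { toFun := fun x => !₂[x.2 0, x.1 0, x.2 1, x.2 2]
      invFun := fun y => (!₂[y 1], !₂[y 0, y 2, y 3])
      map_add' := fun x y => by ext i; fin_cases i <;> simp
      map_smul' := fun c x => by ext i; fin_cases i <;> simp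
      left_inv := fun x => by
        ext i
        · fin_cases i; simp
        · fin_cases i <;> simp
      right_inv := fun y => by ext i; fin_cases i <;> simp }

theorem splitEquiv_apply_zero (u : Model 1) : splitEquiv (u, 0) = u 0 • stdVec 1 := by
  ext i
  fin_cases i <;> simp [splitEquiv, stdVec]

/-- Translating the target chart by `-c` makes the map linear, and `splitEquiv` identifies it with
the standard inclusion `u ↦ (u, 0)`. -/
theorem isImmersionAt_of_affine {P M : Type*} [TopologicalSpace P] [ChartedSpace (Model 1) P]
    [IsManifold (𝓡 1) ∞ P] [TopologicalSpace M] [ChartedSpace (Model 4) M] [IsManifold (𝓡 4) ∞ M]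
    {Φ : P → M} {x : P} (hΦ : ContinuousAt Φ x) {c : Model 4}
    (h : ∀ᶠ z in nhds (extChartAt (𝓡 1) x x),
      writtenInExtChartAt (𝓡 1) (𝓡 4) x Φ z = c + z 0 • stdVec 1) :
    Manifold.IsImmersionAtOfComplement (Model 3) (𝓡 1) (𝓡 4) ∞ Φ x := by
  obtain ⟨V, hV, hVo, hxV⟩ := mem_nhds_iff.mp h
  -- The affine formula holds only near the base point, so the source chart is restricted to where
  -- it does.
  set s : Set P := (chartAt (Model 1) x).source ∩ chartAt (Model 1) x ⁻¹' V with hs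
  have hso : IsOpen s := (chartAt (Model 1) x).isOpen_inter_preimage hVo
  have hxs : x ∈ s := ⟨mem_chart_source _ x, by simpa using hxV⟩
  set T : Model 4 ≃ₜ Model 4 := Homeomorph.addRight (-c) with hT
  have hcod : (chartAt (Model 4) (Φ x)).transHomeomorph T ∈ IsManifold.maximalAtlas (𝓡 4) ∞ M := by
    have hc := IsManifold.chart_mem_maximalAtlas (I := 𝓡 4) (n := ∞) (Φ x)
    refine OpenPartialHomeomorph.mem_maximalAtlas_of_contMDiffOn _ ?_ ?_
    · have h1 : ContMDiff (𝓡 4) (𝓡 4) ∞ T := (contDiff_id.add contDiff_const).contMDiff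
      exact h1.comp_contMDiffOn (contMDiffOn_of_mem_maximalAtlas hc)
    · have h1 : ContMDiff (𝓡 4) (𝓡 4) ∞ T.symm := (contDiff_id.add contDiff_const).contMDiff
      exact (contMDiffOn_symm_of_mem_maximalAtlas hc).comp h1.contMDiffOn fun _ hz => hz
  refine Manifold.IsImmersionAtOfComplement.mk_of_continuousAt hΦ splitEquiv
    ((chartAt (Model 1) x).restr s) ((chartAt (Model 4) (Φ x)).transHomeomorph T)
    ?_ (mem_chart_source _ (Φ x)) ?_ hcod ?_
  · rw [OpenPartialHomeomorph.restr_source, hso.interior_eq]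
    exact ⟨mem_chart_source _ x, hxs⟩
  · exact restr_mem_maximalAtlas _ (IsManifold.chart_mem_maximalAtlas x) hso
  · intro z hz
    have hz' : z ∈ (chartAt (Model 1) x).target ∧ (chartAt (Model 1) x).symm z ∈ s := by
      simpa [hso.interior_eq] using hz
    have hzV : z ∈ V := by
      have := hz'.2.2
      rwa [Set.mem_preimage, (chartAt (Model 1) x).right_inv hz'.1] at this
    have h1 : extChartAt (𝓡 4) (Φ x) (Φ ((extChartAt (𝓡 1) x).symm z)) = c + z 0 • stdVec 1 :=
      hV hzV
    have h2 : splitEquiv (z, 0) =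
        extChartAt (𝓡 4) (Φ x) (Φ ((extChartAt (𝓡 1) x).symm z)) + -c := by
      rw [h1, splitEquiv_apply_zero]
      abel
    exact h2.symm

end Lorentz

/-! ### The circle as a `1`-manifold -/

namespace Kasner

open Lorentz Filter

/-- The covering of the circle by `ℝ¹`. -/
def circleCover (L : ℝ) (u : Model 1) : AddCircle L := (u 0 : AddCircle L)

theorem circleCover_isLocalHomeomorph (L : ℝ) : IsLocalHomeomorph (circleCover L) :=
  (AddCircle.isLocalHomeomorph_coe L).comp
    ((EuclideanSpace.equiv (Fin 1) ℝ).toHomeomorph.trans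
      (Homeomorph.funUnique (Fin 1) ℝ)).isLocalHomeomorph

theorem circleCover_surjective (L : ℝ) : Function.Surjective (circleCover L) := fun θ => by
  obtain ⟨s, rfl⟩ := QuotientAddGroup.mk_surjective θ
  exact ⟨!₂[s], rfl⟩

/-- Charts are local inverses of the covering, as for `CKas L`, so that the loops become affine in
charts. -/
instance (L : ℝ) : ChartedSpace (Model 1) (AddCircle L) :=
  (circleCover_isLocalHomeomorph L).chartedSpace (circleCover_surjective L)

theorem circle_extChartAt_symm {L : ℝ} (θ : AddCircle L) (u : Model 1) :
    (extChartAt (𝓡 1) θ).symm u = circleCover L u :=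
  congrFun ((circleCover_isLocalHomeomorph L).localInverseAt_symm
    (x := (circleCover_surjective L).hasRightInverse.choose θ)) u

/-- A continuous function whose values are multiples of `L` is locally constant. -/
theorem eventually_eq_of_multiple {X : Type*} [TopologicalSpace X] {L : ℝ} (hL : 0 < L)
    {d : X → ℝ} {x : X} (hd : ContinuousAt d x) (h : ∀ᶠ z in nhds x, ∃ n : ℤ, d z = n * L) :
    ∀ᶠ z in nhds x, d z = d x := by
  obtain ⟨n, hn⟩ := h.self_of_nhds
  filter_upwards [h, Metric.continuousAt_iff'.mp hd L hL] with z ⟨k, hk⟩ hz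
  rw [Real.dist_eq, hk, hn, ← sub_mul, abs_mul, abs_of_pos hL] at hz
  have hz2 : |((k - n : ℤ) : ℝ)| < 1 := by
    push_cast
    exact (mul_lt_iff_lt_one_left hL).mp hz
  have hkn : k - n = 0 := by
    rw [← Int.cast_abs] at hz2
    exact Int.abs_lt_one_iff.mp (by exact_mod_cast hz2)
  rw [hk, hn, sub_eq_zero.mp hkn]

theorem exists_sub_eq_multiple {L a b : ℝ} (h : (a : AddCircle L) = b) : ∃ n : ℤ, a - b = n * L := by
  obtain ⟨n, hn⟩ := QuotientAddGroup.eq_iff_sub_mem.mp h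
  exact ⟨n, by simpa using hn.symm⟩

/-- Two local lifts of the same point differ by a multiple of `L`, which by continuity is locally
constant; transition maps are thus locally translations. -/
theorem circle_isManifold {L : ℝ} (hL : 0 < L) : IsManifold (𝓡 1) ∞ (AddCircle L) := by
  refine isManifold_of_contDiffOn _ _ _ fun e e' he he' => ?_
  obtain ⟨θ, rfl⟩ : ∃ θ, chartAt (Model 1) θ = e := he
  obtain ⟨θ', rfl⟩ : ∃ θ', chartAt (Model 1) θ' = e' := he'
  intro y hy
  have hy1 : y ∈ (extChartAt (𝓡 1) θ).target := by simpa using hy.1.1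
  have hy2 : (extChartAt (𝓡 1) θ).symm y ∈ (extChartAt (𝓡 1) θ').source := by simpa using hy.1.2
  set E : Model 1 → Model 1 := fun z => extChartAt (𝓡 1) θ' ((extChartAt (𝓡 1) θ).symm z) with hE
  have hEc : ContinuousAt E y :=
    ContinuousAt.comp (continuousAt_extChartAt' hy2) (continuousAt_extChartAt_symm'' hy1)
  have hproj : ∀ {f : Model 1 → Model 1}, ContinuousAt f y → ContinuousAt (fun z => f z 0) y :=
    fun hf => (EuclideanSpace.proj (𝕜 := ℝ) (0 : Fin 1)).continuous.continuousAt.comp hf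
  have hd := eventually_eq_of_multiple hL (d := fun z => E z 0 - z 0)
    ((hproj hEc).sub (hproj continuousAt_id)) (by
      filter_upwards [(continuousAt_extChartAt_symm'' hy1).preimage_mem_nhds
        ((isOpen_extChartAt_source θ').mem_nhds hy2)] with z hz
      refine exists_sub_eq_multiple ?_
      have h1 := (extChartAt (𝓡 1) θ').left_inv hz
      rw [circle_extChartAt_symm] at h1
      exact h1.trans (circle_extChartAt_symm θ z))
  have hev : E =ᶠ[nhds y] fun z => z + (E y - y) := by
    filter_upwards [hd] with z hz
    ext i
    rw [Subsingleton.elim i 0]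
    simp only [PiLp.add_apply, PiLp.sub_apply]
    linarith
  exact ((contDiffAt_id.add contDiffAt_const).congr_of_eventuallyEq hev).contDiffWithinAt

/-! ### Trapped loops -/

/-- The loop in the first spatial direction at time `t` through the point with last two
coordinates `a`, `b`. -/
def loop (L : ℝ) {t : ℝ} (ht : 0 < t) (a b : ℝ) (θ : AddCircle L) : CKas L :=
  (⟨t, ht⟩, θ, a, b)

variable {p : Fin 3 → ℝ} {L t : ℝ} {a b : ℝ}

theorem continuous_loop (ht : 0 < t) : Continuous (loop L ht a b) := by
  unfold loop
  fun_prop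

theorem written_loop (hL : 0 < L) (ht : 0 < t) (θ : AddCircle L) :
    ∃ c : Model 4, ∀ᶠ z in nhds (extChartAt (𝓡 1) θ θ),
      writtenInExtChartAt (𝓡 1) (𝓡 4) θ (loop L ht a b) z = c + z 0 • stdVec 1 := by
  set y := extChartAt (𝓡 1) θ θ
  set E : Model 1 → Model 4 := writtenInExtChartAt (𝓡 1) (𝓡 4) θ (loop L ht a b)
  have hc : ContinuousAt (fun z => loop L ht a b ((extChartAt (𝓡 1) θ).symm z)) y :=
    (continuous_loop ht).continuousAt.comp (continuousAt_extChartAt_symm θ)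
  have hθ : loop L ht a b ((extChartAt (𝓡 1) θ).symm y) = loop L ht a b θ := by
    rw [extChartAt_to_inv]
  have hEc : ContinuousAt E y :=
    ContinuousAt.comp (g := extChartAt (𝓡 4) (loop L ht a b θ))
      (by rw [Function.comp_apply, hθ]; exact continuousAt_extChartAt _) hc
  have hev : ∀ᶠ z in nhds y, E z 0 = t ∧ (∃ n : ℤ, E z 1 - z 0 = n * L) ∧ E z 2 = a ∧ E z 3 = b := by
    filter_upwards [hc.preimage_mem_nhds (by rw [hθ]; exact extChartAt_source_mem_nhds (I := 𝓡 4) _)]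
      with z hz
    obtain ⟨h1, h2⟩ := ckas_apply hz
    have h3 : quot L ⟨E z, h1⟩ = loop L ht a b (circleCover L z) :=
      h2.trans (congrArg (loop L ht a b) (circle_extChartAt_symm θ z))
    simp only [quot, loop, circleCover, Prod.mk.injEq] at h3
    exact ⟨congrArg Subtype.val h3.1, exists_sub_eq_multiple h3.2.1, h3.2.2⟩
  have hd := eventually_eq_of_multiple hL (d := fun z => E z 1 - z 0)
    (((EuclideanSpace.proj (𝕜 := ℝ) (1 : Fin 4)).continuous.continuousAt.comp hEc).sub
      (EuclideanSpace.proj (𝕜 := ℝ) (0 : Fin 1)).continuous.continuousAt)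
    (hev.mono fun z hz => hz.2.1)
  -- The second entry is the multiple of `L` by which the lifts chosen by the charts of the circle
  -- and of `CKas L` differ near `θ`.
  refine ⟨!₂[t, E y 1 - y 0, a, b], ?_⟩
  filter_upwards [hev, hd] with z hz hz'
  ext i
  fin_cases i
  · simpa [stdVec_apply] using hz.1
  · simp [stdVec_apply]
    linarith
  · simpa [stdVec_apply] using hz.2.2.1
  · simpa [stdVec_apply] using hz.2.2.2

theorem isSmoothEmbedding_loop (hL : 0 < L) (ht : 0 < t) :
    Manifold.IsSmoothEmbedding (𝓡 1) (𝓡 4) ∞ (loop L ht a b) := by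
  have := circle_isManifold hL
  have : Fact (0 < L) := ⟨hL⟩
  refine ⟨Manifold.IsImmersionOfComplement.isImmersion (F := Model 3) fun θ => ?_, ?_⟩
  · obtain ⟨c, hc⟩ := written_loop (a := a) (b := b) hL ht θ
    exact isImmersionAt_of_affine (continuous_loop ht).continuousAt hc
  · refine ((continuous_loop ht).isClosedEmbedding fun θ θ' h => ?_).isEmbedding
    simpa [loop] using h

theorem range_loop (ht : 0 < t) :
    Set.range (loop L ht a b) = {q : CKas L | (q.1 : ℝ) = t ∧ q.2.2.1 = a ∧ q.2.2.2 = b} := by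
  ext ⟨⟨s, hs⟩, θ, x, y⟩
  constructor
  · rintro ⟨θ', h⟩
    simp only [loop, Prod.mk.injEq] at h
    exact ⟨(congrArg Subtype.val h.1).symm, h.2.2.1.symm, h.2.2.2.symm⟩
  · rintro ⟨h1, h2, h3⟩
    obtain rfl : s = t := h1
    obtain rfl : x = a := h2
    obtain rfl : y = b := h3
    exact ⟨θ, rfl⟩

theorem kasnerForm_stdVec_one (p : Fin 3 → ℝ) (t : ℝ) :
    kasnerForm p t (stdVec 1) (stdVec 1) = t ^ (2 * p 0) := by
  rw [kasnerForm_stdVec]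
  rfl

theorem christoffelVec_stdVec_one {y : Model 4} (hy : 0 < y 0) :
    christoffelVec (metricMatrix p) y (stdVec 1) (stdVec 1) =
      (p 0 * (y 0 ^ (2 * p 0) / y 0)) • stdVec 0 := by
  ext i
  refine Fin.cases ?_ (fun j => ?_) i
  · rw [christoffelVec_zero hy, Finset.sum_eq_single 0]
    · simp [stdVec_apply]
    · intro j _ hj
      have : j.succ ≠ 1 := fun h => hj (Fin.succ_injective _ h)
      simp [stdVec_apply, this]
    · simp
  · rw [christoffelVec_succ hy]
    simp [stdVec_apply, Fin.succ_ne_zero]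

/-- The mean curvature vector of a loop in the first spatial direction. -/
theorem normalTrace_loop {y : Model 4} (hy : 0 < y 0) :
    normalTrace (k := 1) (fun v w => kasnerForm p (y 0) v w) (fun _ => stdVec 1)
      (fun _ _ => christoffelVec (metricMatrix p) y (stdVec 1) (stdVec 1)) =
      (-p 0 / y 0) • stdVec 0 := by
  have hpow := Real.rpow_pos_of_pos hy (2 * p 0)
  have h0 : kasnerForm p (y 0) (stdVec 0) (stdVec 1) = 0 := by
    rw [kasnerForm_stdVec]
    rfl
  have hinv : (Matrix.of fun _ _ : Fin 1 => y 0 ^ (2 * p 0))⁻¹ =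
      Matrix.of fun _ _ => (y 0 ^ (2 * p 0))⁻¹ := by
    refine Matrix.inv_eq_left_inv ?_
    ext i j
    rw [Subsingleton.elim i j, Matrix.mul_apply, Matrix.one_apply_eq, Fin.sum_univ_one]
    exact inv_mul_cancel₀ hpow.ne'
  simp only [normalTrace, kasnerForm_stdVec_one, hinv, Fin.sum_univ_one, Matrix.of_apply,
    christoffelVec_stdVec_one hy, map_smul, LinearMap.smul_apply, h0]
  -- The acceleration is a multiple of `∂_t`, already orthogonal to the loop, so the tangential
  -- correction vanishes; the powers `t^{2p₁}` from the metric and its inverse cancel.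
  rw [smul_zero, mul_zero, zero_smul, sub_zero, smul_smul, ← neg_smul]
  congr 1
  field_simp

/-- The loops in the first spatial direction are trapped. -/
theorem isClosedTrapped_loop (hp : p 0 < 0) (hL : 0 < L) (ht : 0 < t) (a b : ℝ) :
    (cKasner p L).IsClosedTrapped 1
      {q : CKas L | (q.1 : ℝ) = t ∧ q.2.2.1 = a ∧ q.2.2.2 = b} := by
  have : Fact (0 < L) := ⟨hL⟩
  have h := cKasner_isLocallyKasner p L
  have hemb := isSmoothEmbedding_loop (a := a) (b := b) hL ht
  have hψ : ∀ θ : AddCircle L, ∀ᶠ z in nhds (extChartAt (𝓡 1) θ θ),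
      fderiv ℝ (writtenInExtChartAt (𝓡 1) (𝓡 4) θ (loop L ht a b)) z =
        (EuclideanSpace.proj (𝕜 := ℝ) (0 : Fin 1)).smulRight (stdVec 1) := fun θ => by
    obtain ⟨c, hc⟩ := written_loop (a := a) (b := b) hL ht θ
    filter_upwards [eventually_eventually_nhds.mpr hc] with z hz
    have h1 : HasFDerivAt (fun z : Model 1 => c + z 0 • (stdVec 1 : Model 4))
        ((EuclideanSpace.proj (𝕜 := ℝ) (0 : Fin 1)).smulRight (stdVec 1)) z :=
      (((EuclideanSpace.proj (𝕜 := ℝ) (0 : Fin 1)).hasFDerivAt).smul_const _).const_add c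
    exact (h1.congr_of_eventuallyEq hz).fderiv
  have hframe : ∀ (θ : AddCircle L) (α : Fin 1),
      fderiv ℝ (writtenInExtChartAt (𝓡 1) (𝓡 4) θ (loop L ht a b)) (extChartAt (𝓡 1) θ θ)
        (stdVec α) = stdVec 1 := fun θ α => by
    rw [(hψ θ).self_of_nhds, Subsingleton.elim α 0]
    simp [stdVec_apply]
  refine ⟨AddCircle L, inferInstance, inferInstance, loop L ht a b, circle_isManifold hL,
    inferInstance, inferInstance, hemb, range_loop ht, fun θ => ?_, fun θ => ?_⟩
  · rw [h.gram_eq (hemb.contMDiff θ) rfl rfl]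
    simp only [hframe, kasnerForm_stdVec_one]
    have : (Matrix.of fun _ _ : Fin 1 => t ^ (2 * p 0)) = Matrix.diagonal fun _ => t ^ (2 * p 0) := by
      ext α β
      rw [Subsingleton.elim α β, Matrix.diagonal_apply_eq, Matrix.of_apply]
    exact this ▸ Matrix.PosDef.diagonal fun _ => Real.rpow_pos_of_pos ht _
  · have hH := h.meanCurvature_eq (hemb.contMDiff θ) rfl rfl
    have hy0 := h.coord_pos (loop L ht a b θ)
    have hτ := h.coord_zero (loop L ht a b θ)
    have hH' : (cKasner p L).meanCurvature (k := 1) (loop L ht a b) θ =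
        ((-p 0 / t) • stdVec 0 : Model 4) := by
      refine hH.trans ?_
      have hτ' : extChartAt (𝓡 4) (loop L ht a b θ) (loop L ht a b θ) 0 = t := hτ
      have hn := normalTrace_loop (p := p) hy0
      rw [hτ'] at hn
      rw [← hn]
      refine normalTrace_congr (fun _ _ => rfl) (hframe θ) fun α β => ?_
      -- The first derivative is constant near the base point, so the acceleration reduces to its
      -- Christoffel term.
      have h2 : fderiv ℝ (fderiv ℝ (writtenInExtChartAt (𝓡 1) (𝓡 4) θ (loop L ht a b)))
          (extChartAt (𝓡 1) θ θ) = 0 := by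
        rw [Filter.EventuallyEq.fderiv_eq (hψ θ)]
        exact fderiv_const_apply _
      rw [coordAccel, h2, hframe, hframe, written_apply]
      simp
    have hpos : 0 < -p 0 / t := div_pos (neg_pos.mpr hp) ht
    have h0 : kasnerForm p t (stdVec 0) (stdVec 0) = -1 := by
      rw [kasnerForm_stdVec]
      rfl
    rw [Spacetime.IsFutureTimelike, hH']
    constructor
    · refine (h.metric_eq _ _ _).trans_lt ?_
      rw [map_smul, map_smul, LinearMap.smul_apply]
      show (-p 0 / t) • (-p 0 / t) • kasnerForm p t (stdVec 0) (stdVec 0) < 0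
      rw [h0]
      simp only [smul_eq_mul]
      nlinarith [mul_pos hpos hpos]
    · refine (h.metric_eq _ _ (stdVec 0)).trans_lt ?_
      rw [map_smul, LinearMap.smul_apply]
      show (-p 0 / t) • kasnerForm p t (stdVec 0) (stdVec 0) < 0
      rw [h0]
      simp only [smul_eq_mul]
      linarith

end Kasner

end

/-! ### The main theorem -/

theorem mainTheorem7 (p : Fin 3 → ℝ) (hsum : ∑ j, p j = 1) (hsq : ∑ j, p j ^ 2 = 1)
    (hord : p 0 ≤ p 1 ∧ p 1 ≤ p 2) (hflat : p ≠ ![0, 0, 1]) (L : ℝ) (hL : 0 < L) :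
    -- the exponents, and the vacuum equations for Kasner spacetime
    (-(1 / 3) ≤ p 0 ∧ p 0 < 0 ∧ 0 < p 1 ∧ p 2 < 1) ∧
    (Kasner.kasner p).IsVacuum ∧
    -- Kasner spacetime is globally foliated by future convex null level sets of a solution
    -- of the eikonal equation
    (ContMDiff (𝓡 4) 𝓘(ℝ, ℝ) ∞ (Kasner.eikonal p) ∧
      (∀ q : Kasner.Kas, ∃ v : TangentSpace (𝓡 4) q,
        (Kasner.kasner p).IsGradient (Kasner.eikonal p) q v ∧
        (Kasner.kasner p).IsFutureNull q v) ∧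
      ∀ c : ℝ, (Kasner.kasner p).IsFutureConvex {q | Kasner.eikonal p q = c}) ∧
    -- Kasner spacetime has no closed trapped submanifolds of any dimension
    (∀ (k : ℕ) (C : Set Kasner.Kas), ¬ (Kasner.kasner p).IsClosedTrapped k C) ∧
    -- future convexity of the slices of constant time, in Kasner and in c-Kasner spacetime
    (∀ t₀ : ℝ, 0 < t₀ →
      (Kasner.kasner p).IsKFutureConvex 3 {q | q.1 0 = t₀} ∧
      (Kasner.kasner p).IsKFutureConvex 2 {q | q.1 0 = t₀} ∧
      ¬ (Kasner.kasner p).IsKFutureConvex 1 {q | q.1 0 = t₀}) ∧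
    (∀ t₀ : ℝ, 0 < t₀ →
      (Kasner.cKasner p L).IsKFutureConvex 3 {q | (q.1 : ℝ) = t₀} ∧
      (Kasner.cKasner p L).IsKFutureConvex 2 {q | (q.1 : ℝ) = t₀} ∧
      ¬ (Kasner.cKasner p L).IsKFutureConvex 1 {q | (q.1 : ℝ) = t₀}) ∧
    -- c-Kasner spacetime has no closed trapped surfaces
    (∀ C : Set (Kasner.CKas L), ¬ (Kasner.cKasner p L).IsClosedTrapped 2 C) ∧
    -- the loops along the first spatial direction in c-Kasner spacetime are trapped loops
    (∀ t₀ a b : ℝ, 0 < t₀ →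
      (Kasner.cKasner p L).IsClosedTrapped 1 {q | (q.1 : ℝ) = t₀ ∧ q.2.2.1 = a ∧ q.2.2.2 = b}) := by
  obtain ⟨h13, h0, h1, h2⟩ := Kasner.exponent_bounds hsum hsq hord hflat
  have h2' : 0 < p 2 := h1.trans_le hord.2
  have hK := Kasner.kasner_isLocallyKasner p
  have hC := Kasner.cKasner_isLocallyKasner p L
  refine ⟨⟨h13, h0, h1, h2⟩, hK.isVacuum hsum hsq, ⟨Kasner.contMDiff_eikonal p,
    Kasner.exists_null_gradient h0, Kasner.isFutureConvex_eikonal h0 h1 h2'⟩,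
    Kasner.kasner_not_isClosedTrapped h0 h1 h2', fun t ht => ⟨?_, ?_, ?_⟩, fun t ht => ⟨?_, ?_, ?_⟩,
    hC.not_isClosedTrapped_surface hsum hord h2,
    fun t a b ht => Kasner.isClosedTrapped_loop h0 hL ht a b⟩
  · exact hK.isKFutureConvex_slice hsum hord h2 (by norm_num) t
  · exact hK.isKFutureConvex_slice hsum hord h2 le_rfl t
  -- Convexity would hold vacuously on an empty set, so a point of the slice is exhibited.
  · exact hK.not_isKFutureConvex_one_slice h0
      (q := ⟨t • Lorentz.stdVec 0, by simpa [Kasner.halfSpace, Lorentz.stdVec_apply] using ht⟩)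
      (by simp [Lorentz.stdVec_apply])
  · exact hC.isKFutureConvex_slice hsum hord h2 (by norm_num) t
  · exact hC.isKFutureConvex_slice hsum hord h2 le_rfl t
  · exact hC.not_isKFutureConvex_one_slice h0 (q := (⟨t, ht⟩, 0, 0, 0)) rfl
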